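/- **Theorem 1.1.** Let $C_1,C_2,C_3>0$. There are a positive integer $P$ and a constant $c_1>0$, depending only on $C_1,C_2,C_3$, such that the following holds. Let $\Omega\subset\mathbb R^N$ ($N\ge1$) be a nonempty bounded open set with boundary $\Gamma$ of class $C^2$, and let ${\bf A}\in C^1(\overline\Omega;\mathbb R^N)$. Let $\mathcal H^1_0$ be the closure of $C_c^\infty(\Omega;\mathbb C)$ in $\{w\in L^2(\Omega):(i\nabla+{\bf A})w\in L^2(\Omega)^N\}$ for the norm $(\|w\|_{L^2}^2+\|(i\nabla+{\bf A})w\|_{L^2}^2)^{1/2}$, and let $(i\nabla+{\bf A})^2$ be the Dirichlet operator given by $\langle(i\nabla+{\bf A})^2w,v\rangle=((i\nabla+{\bf A})w,(i\nabla+{\bf A})v)_{L^2}$ for $w,v\in\mathcal H^1_0$. Then $L^2(\Omega)$ has an orthonormal basis $(\phi_k)_{k\in\mathbb N}$ of functions $\phi_k\in\mathcal H_0^1$ with $(i\nabla+{\bf A})^2\phi_k=\lambda_k^2\phi_k$, $\lambda_k>0$. Fix any such basis. Represent (generalized) functions on $\Omega$ by formal series $a=\sum_k a_k\phi_k$, $a_k\in\mathbb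 C$ (where $a_k=(a,\phi_k)_{L^2}$ if $a\in L^2(\Omega)$), and put $$H^s=\Big\{a:\ \|a\|_{H^s}^2=\sum_k\lambda_k^{2s}|a_k|^2<\infty\Big\},\qquad F\big(\sqrt{(i\nabla+{\bf A})^2}\big)a=\sum_kF(\lambda_k)a_k\phi_k .$$ For $F>0$ the space $F(\sqrt{(i\nabla+{\bf A})^2})H^s$ carries the norm transported from $H^s$. Let $T>0$, and let $\nu\in C(0,T]$ be strictly decreasing with $\inf_{(0,T]}\nu>0$. Put $\mu(t)=t/\nu(t)$, an increasing bijection of $(0,T]$ onto $(0,\mu(T)]$, with inverse $\mu^{-1}$, and set $\mu^{-1}(r)=T$ for $r>\mu(T)$. Let $b\in C^2((0,T];\mathbb R)$ satisfy, for all $t\in(0,T]$, $$C_1\le b(t)\le C_2,\qquad \Big|\frac{d^kb}{dt^k}(t)\Big|\le C_3\Big(\frac{\nu(t)}t\Big)^k\quad(k=1,2).$$ Then for every $s\ge1$ and $(u_0,u_1)\in H^s\times H^{s-1}$ the problem $$u_{tt}+b(t)^2(i\nabla+{\bf A}(x))^2u=0\ \text{ in }(0,T)\times\Omega,\qquad u=0\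 \text{ on }(0,T)\times\Gamma,\qquad u(0)=u_0,\ u_t(0)=u_1,$$ has a unique solution $u$, and $$u\in C\Big([0,T];\exp\big(c_1\nu(\mu^{-1}(2^P/\sqrt{(i\nabla+{\bf A})^2}))\big)H^s\Big),\qquad u_t\in C\Big([0,T];\exp\big(c_1\nu(\mu^{-1}(2^P/\sqrt{(i\nabla+{\bf A})^2}))\big)H^{s-1}\Big).$$ Here a solution is a function $u$ on $[0,T]$ with values in the formal series such that every coefficient $u_k$ is differentiable on $[0,T]$ and twice differentiable on $(0,T)$, $u_k''+b^2\lambda_k^2u_k=0$ on $(0,T)$, and $u_k(0)=(u_0,\phi_k)_{L^2}$, $u_k'(0)=(u_1,\phi_k)_{L^2}$; that is, the equation and the Dirichlet condition hold in the dual of the span of the eigenfunctions. -/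

import Mathlib

open MeasureTheory Set Filter Topology
open scoped ContDiff ENNReal

noncomputable section

namespace MagneticWave

/-- The complex Hilbert space `L²(Ω)`. -/
abbrev L2 {N : ℕ} (Ω : Set (EuclideanSpace ℝ (Fin N))) : Type :=
  Lp ℂ 2 (volume.restrict Ω)

/-- `Ω` has boundary of class `C²`: near every boundary point, `Ω` is the negativity set of a
`C²` function with nonvanishing gradient (equivalently, `Ω` lies locally on one side of the graph
of a `C²` function). -/
def HasC2Boundary {N : ℕ} (Ω : Set (EuclideanSpace ℝ (Fin N))) : Prop :=
  ∀ x ∈ frontier Ω, ∃ U ∈ 𝓝 x, ∃ ρ : EuclideanSpace ℝ (Fin N) → ℝ,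
    ContDiff ℝ 2 ρ ∧ fderiv ℝ ρ x ≠ 0 ∧ ∀ y ∈ U, (y ∈ Ω ↔ ρ y < 0)

/-- Membership in the space of test functions `𝓓(Ω) = C_c^∞(Ω; ℂ)`. -/
def IsTestFunction {N : ℕ} (Ω : Set (EuclideanSpace ℝ (Fin N)))
    (ψ : EuclideanSpace ℝ (Fin N) → ℂ) : Prop :=
  ContDiff ℝ ∞ ψ ∧ HasCompactSupport ψ ∧ tsupport ψ ⊆ Ω

/-- The classical partial derivative `∂_j ψ`. -/
def partialDeriv {N : ℕ} (j : Fin N) (ψ : EuclideanSpace ℝ (Fin N) → ℂ)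
    (x : EuclideanSpace ℝ (Fin N)) : ℂ :=
  fderiv ℝ ψ x (EuclideanSpace.single j 1)

/-- The `j`-th component of `(i∇ + A)ψ` for a smooth function `ψ`. -/
def magneticPartial {N : ℕ} (A : EuclideanSpace ℝ (Fin N) → EuclideanSpace ℝ (Fin N))
    (j : Fin N) (ψ : EuclideanSpace ℝ (Fin N) → ℂ) (x : EuclideanSpace ℝ (Fin N)) : ℂ :=
  Complex.I * partialDeriv j ψ x + ((A x j : ℝ) : ℂ) * ψ x

/-- `g = (i∇ + A)w` on `Ω` in the sense of distributions, with `w` and all `g j` in `L²(Ω)`.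
So `w ∈ 𝓗¹(Ω)` iff such a `g` exists. -/
def IsMagneticGradient {N : ℕ} (Ω : Set (EuclideanSpace ℝ (Fin N)))
    (A : EuclideanSpace ℝ (Fin N) → EuclideanSpace ℝ (Fin N))
    (w : L2 Ω) (g : Fin N → L2 Ω) : Prop :=
  ∀ ψ, IsTestFunction Ω ψ → ∀ j : Fin N,
    ∫ x in Ω, g j x * ψ x =
      ∫ x in Ω, w x * (-Complex.I * partialDeriv j ψ x + ((A x j : ℝ) : ℂ) * ψ x)

/-- `w ∈ 𝓗¹₀(Ω)` with `(i∇ + A)w = g`: here `𝓗¹₀(Ω)` is the closure of `𝓓(Ω)` in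
`𝓗¹(Ω)` for the norm `(‖w‖² + ‖(i∇ + A)w‖²)^{1/2}`. -/
def IsDirichlet {N : ℕ} (Ω : Set (EuclideanSpace ℝ (Fin N)))
    (A : EuclideanSpace ℝ (Fin N) → EuclideanSpace ℝ (Fin N))
    (w : L2 Ω) (g : Fin N → L2 Ω) : Prop :=
  IsMagneticGradient Ω A w g ∧
  ∃ ψ : ℕ → EuclideanSpace ℝ (Fin N) → ℂ, (∀ n, IsTestFunction Ω (ψ n)) ∧
    Tendsto (fun n => eLpNorm (fun x => ψ n x - w x) 2 (volume.restrict Ω)) atTop (𝓝 0) ∧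
    ∀ j : Fin N, Tendsto
      (fun n => eLpNorm (fun x => magneticPartial A j (ψ n) x - g j x) 2 (volume.restrict Ω))
      atTop (𝓝 0)

/-- `φ ∈ 𝓗¹₀(Ω)` and `(i∇ + A)²φ = Λ φ` in `𝓗⁻¹(Ω)`, i.e.
`((i∇ + A)φ, (i∇ + A)v) = Λ (φ, v)` for all `v ∈ 𝓗¹₀(Ω)`. -/
def IsDirichletEigenfunction {N : ℕ} (Ω : Set (EuclideanSpace ℝ (Fin N)))
    (A : EuclideanSpace ℝ (Fin N) → EuclideanSpace ℝ (Fin N)) (Λ : ℝ) (φ : L2 Ω) : Prop :=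
  ∃ g : Fin N → L2 Ω, IsDirichlet Ω A φ g ∧
    ∀ (v : L2 Ω) (h : Fin N → L2 Ω), IsDirichlet Ω A v h →
      ∑ j, inner ℂ (h j) (g j) = (Λ : ℂ) * inner ℂ v φ

/-- An orthonormal basis `(φ_k)` of `L²(Ω)` made of eigenfunctions of the Dirichlet realization of
`(i∇ + A)²`, with eigenvalues `λ_k²`, `λ_k > 0` (repeated according to multiplicity). -/
structure Eigenbasis {N : ℕ} (Ω : Set (EuclideanSpace ℝ (Fin N)))
    (A : EuclideanSpace ℝ (Fin N) → EuclideanSpace ℝ (Fin N)) where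
  φ : HilbertBasis ℕ ℂ (L2 Ω)
  lam : ℕ → ℝ
  lam_pos : ∀ k, 0 < lam k
  eigen : ∀ k, IsDirichletEigenfunction Ω A (lam k ^ 2) (φ k)

namespace Eigenbasis

variable {N : ℕ} {Ω : Set (EuclideanSpace ℝ (Fin N))}
  {A : EuclideanSpace ℝ (Fin N) → EuclideanSpace ℝ (Fin N)} (Φ : Eigenbasis Ω A)

/-- The Fourier coefficients `f̂(k) = (f, φ_k) = ∫ f \bar{φ_k}` of `f ∈ L²(Ω)`. A (generalized)
function on `Ω` is represented below by its coefficients, i.e. by the formal expansion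
`∑ a_k φ_k` with `a : ℕ → ℂ`. -/
def coeff (f : L2 Ω) (k : ℕ) : ℂ := inner ℂ (Φ.φ k) f

/-- The operator `F(√((i∇ + A)²))`: multiplication of the `k`-th coefficient by `F(λ_k)`. -/
def fn (F : ℝ → ℝ) (a : ℕ → ℂ) (k : ℕ) : ℂ := (F (Φ.lam k) : ℂ) * a k

/-- `∑ a_k φ_k ∈ H^s`, the Sobolev space of order `s` of the operator: `∑ λ_k^{2s} |a_k|² < ∞`. -/
def MemSobolev (s : ℝ) (a : ℕ → ℂ) : Prop :=
  Summable fun k => Φ.lam k ^ (2 * s) * ‖a k‖ ^ 2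

/-- The square of the `H^s`-norm. -/
def sobolevNormSq (s : ℝ) (a : ℕ → ℂ) : ℝ :=
  ∑' k, Φ.lam k ^ (2 * s) * ‖a k‖ ^ 2

/-- `v ∈ C([0,T]; H^s)`. -/
def ContinuousInSobolev (T s : ℝ) (v : ℝ → ℕ → ℂ) : Prop :=
  (∀ t ∈ Icc 0 T, Φ.MemSobolev s (v t)) ∧
  ∀ t ∈ Icc 0 T, Tendsto (fun τ => Φ.sobolevNormSq s (v τ - v t)) (𝓝[Icc 0 T] t) (𝓝 0)

/-- `u ∈ C([0,T]; F(√((i∇ + A)²)) H^s)` for a positive function `F`: `u = F(√((i∇ + A)²)) v` with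
`v ∈ C([0,T]; H^s)`; the norm on `F(√((i∇ + A)²)) H^s` is the one transported from `H^s`. -/
def ContinuousInImage (F : ℝ → ℝ) (T s : ℝ) (u : ℝ → ℕ → ℂ) : Prop :=
  ∃ v : ℝ → ℕ → ℂ, Φ.ContinuousInSobolev T s v ∧ ∀ t ∈ Icc 0 T, u t = Φ.fn F (v t)

/-- `u`, with time derivative `u_t = ut`, solves `u_tt + b(t)² (i∇ + A)² u = 0` on `(0,T)` with
Dirichlet boundary condition and `u(0) = u₀`, `u_t(0) = u₁`. As the values `u(t)` may be
non-distributional (the loss of regularity may be infinite), the equation is understood in the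
dual of the space of finite linear combinations of eigenfunctions. -/
structure IsSolution (T : ℝ) (b : ℝ → ℝ) (u₀ u₁ : L2 Ω) (u ut : ℝ → ℕ → ℂ) : Prop where
  init : u 0 = Φ.coeff u₀
  init_t : ut 0 = Φ.coeff u₁
  deriv : ∀ k, ∀ t ∈ Icc 0 T, HasDerivWithinAt (fun τ => u τ k) (ut t k) (Icc 0 T) t
  equation : ∀ k, ∀ t ∈ Ioo 0 T,
    HasDerivAt (fun τ => ut τ k) (-((b t : ℂ) ^ 2 * Φ.fn (fun l => l ^ 2) (u t) k)) t

end Eigenbasis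

/-- The inverse of `μ(t) = t / ν(t)`, which is an increasing bijection of `(0,T]` onto
`(0, μ(T)]`; it is extended by the constant value `T` to arguments above `μ(T)`. -/
def muInv (T : ℝ) (ν : ℝ → ℝ) (r : ℝ) : ℝ :=
  open Classical in
  if r ≤ T / ν T then Function.invFunOn (fun t => t / ν t) (Ioc 0 T) r else T

/-- The symbol `λ ↦ exp(c ν(μ⁻¹(2^P / λ)))`. -/
def lossSymbol (T : ℝ) (ν : ℝ → ℝ) (P : ℕ) (c : ℝ) (l : ℝ) : ℝ :=
  Real.exp (c * ν (muInv T ν (2 ^ P / l)))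

end MagneticWave

end

/-! Expansion in eigenfunctions reduces the equation to oscillators `u'' + b²λ²u = 0`, one per
frequency `λ`, so everything rests on an energy bound with explicit dependence on `λ`
(`energy_le_loss`). Put `M = 2^P` and cut `[0,T]` at `α = μ⁻¹(M/λ)`; unless `α` is the default value
`T`, this means `λα = Mν(α)`.

Before `α` the derivatives of `b` may be too large to be useful. Gronwall's inequality with the mere
bound on `b` (`energy_le_exp`) costs a factor `exp(Cλα)`, at most `exp(CMν(α))`.

After `α` the energy `|u'|²/b + bλ²|u|²` is used (`adiabatic_energy_le`). Its derivative is
`-(b'/b²)(|u'|² - b²λ²|u|²)`, and the last bracket is the derivative of `(u,u')`. Adding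
`(b'/b²)(u,u')` therefore cancels the terms of first order in `b'` and leaves `(b'/b²)'(u,u')`, a
relative rate of order `(ν(α)/t)²/λ`. Its integral over `[α,T]` is at most a multiple of `ν(α)²/(λα)
= ν(α)/M`. Both losses are multiples of `ν(α)`, which is the exponent of the symbol. Dominated
convergence over the frequencies then gives continuity in time, and uniqueness holds coefficient by
coefficient.

The eigenbasis comes from the embedding `J` of `𝓗¹₀` into `L²(Ω)`. A Fourier-analytic form of
Rellich's theorem (`exists_finset_norm_sq_le`) makes `J` compact, so `J J*` is diagonalizable. An
eigenvalue `m` of `J J*` corresponds to the Dirichlet eigenvalue `m⁻¹ - 1`, positive by a Poincaré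
inequality for the magnetic gradient. -/

namespace MagneticWave

open MeasureTheory Set Filter Topology
open scoped ContDiff ENNReal NNReal FourierTransform

/-! ### Energy estimates for a single oscillator. -/

section

/-- Gronwall's inequality in differential form, with a variable rate `φ'`. -/
theorem le_mul_exp_of_hasDerivAt_le {E E' φ φ' : ℝ → ℝ} {α β : ℝ}
    (hE : ContinuousOn E (Icc α β)) (hφ : ContinuousOn φ (Icc α β))
    (hE' : ∀ t ∈ Ioo α β, HasDerivAt E (E' t) t) (hφ' : ∀ t ∈ Ioo α β, HasDerivAt φ (φ' t) t)
    (h : ∀ t ∈ Ioo α β, E' t ≤ φ' t * E t) {t : ℝ} (ht : t ∈ Icc α β) :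
    E t ≤ E α * Real.exp (φ t - φ α) := by
  have hanti : AntitoneOn (fun τ => E τ * Real.exp (-φ τ)) (Icc α β) := by
    apply antitoneOn_of_hasDerivWithinAt_nonpos (convex_Icc α β)
      (f' := fun τ => E' τ * Real.exp (-φ τ) + E τ * (Real.exp (-φ τ) * (-φ' τ)))
    · exact hE.mul (Real.continuous_exp.comp_continuousOn hφ.neg)
    · intro τ hτ
      rw [interior_Icc] at hτ
      exact ((hE' τ hτ).mul (hφ' τ hτ).neg.exp).hasDerivWithinAt
    · intro τ hτ
      rw [interior_Icc] at hτ
      have h1 := h τ hτ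
      have h2 := Real.exp_pos (-φ τ)
      nlinarith
  have h1 := hanti ⟨le_rfl, ht.1.trans ht.2⟩ ht ht.1
  have h2 : E t = E t * Real.exp (-φ t) * Real.exp (φ t) := by
    rw [mul_assoc, ← Real.exp_add]; simp
  rw [h2]
  calc E t * Real.exp (-φ t) * Real.exp (φ t)
      ≤ E α * Real.exp (-φ α) * Real.exp (φ t) := by gcongr
    _ = _ := by rw [mul_assoc, ← Real.exp_add]; ring_nf

theorem two_mul_norm_mul_norm_le {F : Type*} [NormedAddCommGroup F] (x y : F) {l : ℝ} (hl : 0 < l) :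
    2 * (‖x‖ * ‖y‖) ≤ (l ^ 2 * ‖x‖ ^ 2 + ‖y‖ ^ 2) / l := by
  rw [le_div_iff₀ hl]
  nlinarith [sq_nonneg (l * ‖x‖ - ‖y‖)]

section Energy

variable {F : Type*} [NormedAddCommGroup F] [InnerProductSpace ℝ F]

/-- The energy `λ²|u|² + |u'|²` of a solution of `u'' + q u = 0` grows at most
exponentially with rate `Kλ` if `|λ² - q| ≤ Kλ²`. -/
theorem energy_le_exp {u ut : ℝ → F} {q : ℝ → ℝ} {α β l K : ℝ} (hl : 0 < l)
    (hu : ContinuousOn u (Icc α β)) (hut : ContinuousOn ut (Icc α β))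
    (hu' : ∀ t ∈ Ioo α β, HasDerivAt u (ut t) t)
    (hut' : ∀ t ∈ Ioo α β, HasDerivAt ut (-(q t • u t)) t)
    (hq : ∀ t ∈ Ioo α β, |l ^ 2 - q t| ≤ K * l ^ 2) {t : ℝ} (ht : t ∈ Icc α β) :
    l ^ 2 * ‖u t‖ ^ 2 + ‖ut t‖ ^ 2 ≤
      (l ^ 2 * ‖u α‖ ^ 2 + ‖ut α‖ ^ 2) * Real.exp (K * l * (t - α)) := by
  have key := le_mul_exp_of_hasDerivAt_le (E := fun t => l ^ 2 * ‖u t‖ ^ 2 + ‖ut t‖ ^ 2)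
    (φ := fun t => K * l * t) (φ' := fun _ => K * l)
    (E' := fun t => l ^ 2 * (2 * inner ℝ (u t) (ut t)) + 2 * inner ℝ (ut t) (-(q t • u t)))
    (by fun_prop) (by fun_prop)
    (fun t ht => ((hu' t ht).norm_sq.const_mul _).add (hut' t ht).norm_sq)
    (fun t _ => by simpa using (hasDerivAt_id t).const_mul (K * l)) ?_ ht
  · simpa [mul_sub] using key
  · intro τ hτ
    have h1 : l ^ 2 * (2 * inner ℝ (u τ) (ut τ)) + 2 * inner ℝ (ut τ) (-(q τ • u τ)) =
        (l ^ 2 - q τ) * (2 * inner ℝ (u τ) (ut τ)) := by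
      rw [inner_neg_right, inner_smul_right, real_inner_comm]; ring
    have h2 : |(2 : ℝ) * inner ℝ (u τ) (ut τ)| ≤ (l ^ 2 * ‖u τ‖ ^ 2 + ‖ut τ‖ ^ 2) / l := by
      rw [abs_mul, abs_two]
      exact (mul_le_mul_of_nonneg_left (abs_real_inner_le_norm _ _) two_pos.le).trans
        (two_mul_norm_mul_norm_le _ _ hl)
    simp only [h1]
    calc (l ^ 2 - q τ) * (2 * inner ℝ (u τ) (ut τ))
        ≤ |l ^ 2 - q τ| * |2 * inner ℝ (u τ) (ut τ)| := by rw [← abs_mul]; exact le_abs_self _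
      _ ≤ (K * l ^ 2) * ((l ^ 2 * ‖u τ‖ ^ 2 + ‖ut τ‖ ^ 2) / l) :=
          mul_le_mul (hq τ hτ) h2 (abs_nonneg _) ((abs_nonneg _).trans (hq τ hτ))
      _ = _ := by field_simp

/-- In the hyperbolic zone, the adiabatic energy `|u'|²/b + bλ²|u|²` of a solution of
`u'' + b²λ²u = 0` stays bounded, up to the factor `exp(K n²/(λ α))`. The proof corrects the energy
by the term `(b'/b²)(u, u')`, which leaves only second order terms in its derivative. -/
theorem adiabatic_energy_le {u ut : ℝ → F} {b b' b'' m : ℝ → ℝ} {α β l C₁ C₃ M n : ℝ}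
    (hα : 0 < α) (hl : 0 < l) (hC₁ : 0 < C₁) (hM : 0 < M) (hM' : C₃ / C₁ ^ 2 ≤ M)
    (hu : ContinuousOn u (Icc α β)) (hut : ContinuousOn ut (Icc α β))
    (hu' : ∀ t ∈ Ioo α β, HasDerivAt u (ut t) t)
    (hut' : ∀ t ∈ Ioo α β, HasDerivAt ut (-((b t ^ 2 * l ^ 2) • u t)) t)
    (hb : ContinuousOn b (Icc α β)) (hbc : ContinuousOn b' (Icc α β))
    (hb' : ∀ t ∈ Ioo α β, HasDerivAt b (b' t) t)
    (hb'' : ∀ t ∈ Ioo α β, HasDerivAt b' (b'' t) t)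
    (hbC : ∀ t ∈ Icc α β, C₁ ≤ b t)
    (hbm : ∀ t ∈ Icc α β, |b' t| ≤ C₃ * m t) (hbm' : ∀ t ∈ Icc α β, |b'' t| ≤ C₃ * m t ^ 2)
    (hm : ∀ t ∈ Icc α β, 0 ≤ m t) (hmn : ∀ t ∈ Icc α β, m t ≤ n / t)
    (hmM : ∀ t ∈ Icc α β, m t ≤ l / M) (hC₃ : 0 ≤ C₃) {t : ℝ} (ht : t ∈ Icc α β) :
    ‖ut t‖ ^ 2 / b t + b t * l ^ 2 * ‖u t‖ ^ 2 ≤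
      3 * (‖ut α‖ ^ 2 / b α + b α * l ^ 2 * ‖u α‖ ^ 2) *
        Real.exp ((C₃ / C₁ ^ 2 + 2 * C₃ ^ 2 / C₁ ^ 3) * n ^ 2 / (l * α)) := by
  set K := C₃ / C₁ ^ 2 + 2 * C₃ ^ 2 / C₁ ^ 3 with hK
  have hK0 : 0 ≤ K := by positivity
  set E₁ : ℝ → ℝ := fun t => ‖ut t‖ ^ 2 / b t + b t * l ^ 2 * ‖u t‖ ^ 2 with hE₁
  set E₂ : ℝ → ℝ := fun t => E₁ t + b' t / b t ^ 2 * inner ℝ (u t) (ut t) with hE₂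
  have hb0 : ∀ t ∈ Icc α β, 0 < b t := fun t ht => hC₁.trans_le (hbC t ht)
  have hbn : ∀ t ∈ Icc α β, b t ≠ 0 := fun t ht => (hb0 t ht).ne'
  have hE₁0 : ∀ t ∈ Icc α β, 0 ≤ E₁ t := fun t ht => by
    have := hb0 t ht; simp only [hE₁]; positivity
  have hin : ∀ t ∈ Icc α β, |inner ℝ (u t) (ut t)| ≤ E₁ t / (2 * l) := fun t ht => by
    have h0 := hb0 t ht
    refine (abs_real_inner_le_norm _ _).trans ?_
    rw [le_div_iff₀ (by positivity)]
    have : E₁ t = ((b t * l * ‖u t‖) ^ 2 + ‖ut t‖ ^ 2) / b t := by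
      simp only [hE₁]; field_simp; ring
    rw [this, le_div_iff₀ h0]
    nlinarith [sq_nonneg (b t * l * ‖u t‖ - ‖ut t‖)]
  -- The bounds `m ≤ l / M` and `C₃ / C₁² ≤ M` make the correction at most half of `E₁`. Hence `E₁ /
  -- 2 ≤ E₂ ≤ 3 E₁ / 2`, the source of the factor `3`.
  have hcor : ∀ t ∈ Icc α β, |b' t / b t ^ 2 * inner ℝ (u t) (ut t)| ≤ E₁ t / 2 := fun t ht => by
    have h0 := hb0 t ht
    have h1 : |b' t / b t ^ 2| ≤ l := by
      rw [abs_div, abs_of_nonneg (sq_nonneg (b t)), div_le_iff₀ (by positivity)]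
      calc |b' t| ≤ C₃ * (l / M) := (hbm t ht).trans (by gcongr; exact hmM t ht)
        _ ≤ l * C₁ ^ 2 := by
            rw [div_le_iff₀ (by positivity)] at hM'
            rw [← mul_div_assoc, div_le_iff₀ hM]
            nlinarith
        _ ≤ l * b t ^ 2 := by gcongr; exact hbC t ht
    rw [abs_mul]
    calc _ ≤ l * (E₁ t / (2 * l)) := mul_le_mul h1 (hin t ht) (abs_nonneg _) hl.le
      _ = E₁ t / 2 := by field_simp
  have hlow : ∀ t ∈ Icc α β, E₁ t ≤ 2 * E₂ t := fun t ht => by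
    have := (abs_le.1 (hcor t ht)).1; simp only [hE₂]; linarith
  have hα' : α ∈ Icc α β := ⟨le_rfl, ht.1.trans ht.2⟩
  -- The rate is `K n² / (l t²)`; its integral from `α` is at most `K n² / (l α)`.
  have key := le_mul_exp_of_hasDerivAt_le (E := E₂)
    (φ := fun t => -(K * n ^ 2 / l) * t⁻¹) (φ' := fun t => -(K * n ^ 2 / l) * (-(t ^ 2)⁻¹))
    (E' := fun t => (b'' t / b t ^ 2 - 2 * b' t ^ 2 / b t ^ 3) * inner ℝ (u t) (ut t))
    ?_ ?_ ?_ ?_ ?_ ht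
  · calc E₁ t ≤ 2 * E₂ t := hlow t ht
      _ ≤ 2 * (E₂ α * Real.exp (-(K * n ^ 2 / l) * t⁻¹ - -(K * n ^ 2 / l) * α⁻¹)) := by
          gcongr
      _ ≤ 2 * ((3 / 2 * E₁ α) * Real.exp (K * n ^ 2 / (l * α))) := by
          have ht0 : 0 < t := hα.trans_le ht.1
          have h1 : E₂ α ≤ 3 / 2 * E₁ α := by
            have := (abs_le.1 (hcor α hα')).2; simp only [hE₂]; linarith
          have h2 : -(K * n ^ 2 / l) * t⁻¹ - -(K * n ^ 2 / l) * α⁻¹ ≤ K * n ^ 2 / (l * α) := by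
            have : 0 ≤ (K * n ^ 2 / l) * t⁻¹ := by positivity
            have h3 : K * n ^ 2 / (l * α) = (K * n ^ 2 / l) * α⁻¹ := by field_simp
            linarith
          have h4 : 0 ≤ 3 / 2 * E₁ α := by have := hE₁0 α hα'; positivity
          gcongr
      _ = _ := by ring
  · have hb2 : ∀ t ∈ Icc α β, b t ^ 2 ≠ 0 := fun t ht => pow_ne_zero 2 (hbn t ht)
    exact (((hut.norm.pow 2).div hb hbn).add ((hb.mul continuousOn_const).mul (hu.norm.pow 2))).add
      ((hbc.div (hb.pow 2) hb2).mul (hu.inner hut))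
  · exact continuousOn_const.mul (continuousOn_id.inv₀ fun t ht => (hα.trans_le ht.1).ne')
  · intro τ hτ
    have hτ' := Ioo_subset_Icc_self hτ
    have h0 := hbn τ hτ'
    have d1 := ((hut' τ hτ).norm_sq.div (hb' τ hτ) h0).add
      (((hb' τ hτ).mul_const (l ^ 2)).mul (hu' τ hτ).norm_sq)
    have d2 := ((hb'' τ hτ).div ((hb' τ hτ).pow 2) (pow_ne_zero 2 h0)).mul
      ((hu' τ hτ).inner ℝ (hut' τ hτ))
    -- The terms of first order in `b'` cancel between `d1` and `d2`.
    refine (d1.add d2).congr_deriv ?_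
    simp only [Pi.pow_apply, Pi.div_apply, inner_neg_right, inner_smul_right,
      real_inner_self_eq_norm_sq,
      real_inner_comm (u τ) (ut τ)]
    push_cast
    field_simp
    ring
  · intro τ hτ
    have := (hasDerivAt_inv (hα.trans hτ.1).ne').const_mul (-(K * n ^ 2 / l))
    exact this
  · intro τ hτ
    have hτ' := Ioo_subset_Icc_self hτ
    have h0 := hb0 τ hτ'
    have hτ0 : 0 < τ := hα.trans hτ.1
    have hm0 := hm τ hτ'
    have hR : |b'' τ / b τ ^ 2 - 2 * b' τ ^ 2 / b τ ^ 3| ≤ K * (n / τ) ^ 2 := by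
      have e1 : |b'' τ / b τ ^ 2| ≤ C₃ * m τ ^ 2 / C₁ ^ 2 := by
        rw [abs_div, abs_of_nonneg (sq_nonneg (b τ))]
        gcongr
        · exact hbm' τ hτ'
        · exact hbC τ hτ'
      have e2 : |2 * b' τ ^ 2 / b τ ^ 3| ≤ 2 * (C₃ * m τ) ^ 2 / C₁ ^ 3 := by
        rw [abs_div, abs_of_pos (pow_pos h0 3), abs_mul, abs_two, abs_pow]
        gcongr
        · exact hbm τ hτ'
        · exact hbC τ hτ'
      calc _ ≤ C₃ * m τ ^ 2 / C₁ ^ 2 + 2 * (C₃ * m τ) ^ 2 / C₁ ^ 3 :=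
            (abs_sub _ _).trans (add_le_add e1 e2)
        _ = K * m τ ^ 2 := by rw [hK]; ring
        _ ≤ _ := by gcongr; exact hmn τ hτ'
    have hE₂l := hlow τ hτ'
    calc _ ≤ |b'' τ / b τ ^ 2 - 2 * b' τ ^ 2 / b τ ^ 3| * |inner ℝ (u τ) (ut τ)| := by
          rw [← abs_mul]; exact le_abs_self _
      _ ≤ (K * (n / τ) ^ 2) * (E₁ τ / (2 * l)) :=
          mul_le_mul hR (hin τ hτ') (abs_nonneg _) (by positivity)
      _ ≤ (K * (n / τ) ^ 2) * (2 * E₂ τ / (2 * l)) := by gcongr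
      _ = _ := by field_simp

end Energy

end

/-! ### Existence, uniqueness and regularity for the scalar equation. -/

section

/-- If `u` is differentiable on `[0,T]` and `u'` is Lipschitz in the interior, then `u'` is
continuous up to the boundary. -/
theorem continuousOn_of_hasDerivWithinAt_of_lipschitzOnWith {u ut : ℝ → ℂ} {T : ℝ} (hT : 0 < T)
    {K : ℝ≥0} (hu : ∀ t ∈ Icc 0 T, HasDerivWithinAt u (ut t) (Icc 0 T) t)
    (hK : LipschitzOnWith K ut (Ioo 0 T)) : ContinuousOn ut (Icc 0 T) := by
  -- The extension `g` provides limits of `u'` at both endpoints. A limit of derivatives is the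
  -- one-sided derivative, so `ut` equals `g` there too.
  obtain ⟨g, hg, hgu⟩ := hK.extend_finite_dimension
  have hgc := hg.continuous
  have hd : ∀ t ∈ Ioo 0 T, HasDerivAt u (ut t) t := fun t ht =>
    (hu t (Ioo_subset_Icc_self ht)).hasDerivAt (Icc_mem_nhds ht.1 ht.2)
  have hdiff : DifferentiableOn ℝ u (Ioo 0 T) := fun t ht =>
    (hd t ht).differentiableAt.differentiableWithinAt
  have hderiv : EqOn (deriv u) g (Ioo 0 T) := fun t ht => by rw [(hd t ht).deriv, hgu ht]
  have h0 : HasDerivWithinAt u (g 0) (Ici 0) 0 := by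
    refine hasDerivWithinAt_Ici_of_tendsto_deriv hdiff
      ((hu 0 ⟨le_rfl, hT.le⟩).continuousWithinAt.mono Ioo_subset_Icc_self) (Ioo_mem_nhdsGT hT) ?_
    exact (hgc.continuousWithinAt.tendsto).congr'
      (eventually_of_mem (Ioo_mem_nhdsGT hT) fun t ht => (hderiv ht).symm)
  have h1 : HasDerivWithinAt u (g T) (Iic T) T := by
    refine hasDerivWithinAt_Iic_of_tendsto_deriv hdiff
      ((hu T ⟨hT.le, le_rfl⟩).continuousWithinAt.mono Ioo_subset_Icc_self) (Ioo_mem_nhdsLT hT) ?_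
    exact (hgc.continuousWithinAt.tendsto).congr'
      (eventually_of_mem (Ioo_mem_nhdsLT hT) fun t ht => (hderiv ht).symm)
  refine hgc.continuousOn.congr fun t ht => ?_
  have hun := uniqueDiffOn_Icc hT t ht
  rcases eq_or_lt_of_le ht.1 with rfl | ht0
  · exact hun.eq_deriv _ (hu _ ht) (h0.mono Icc_subset_Ici_self)
  rcases eq_or_lt_of_le ht.2 with rfl | htT
  · exact hun.eq_deriv _ (hu _ ht) (h1.mono Icc_subset_Iic_self)
  · exact hgu ⟨ht0, htT⟩

section LinearODE

variable {q : ℝ → ℝ} {T Q : ℝ}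

/-- The derivative of a solution of `u'' + q u = 0` with bounded `q` is continuous on `[0,T]`. -/
theorem continuousOn_deriv_of_ode (hT : 0 < T) (hQ : ∀ t ∈ Ioo 0 T, |q t| ≤ Q) {u ut : ℝ → ℂ}
    (hu : ∀ t ∈ Icc 0 T, HasDerivWithinAt u (ut t) (Icc 0 T) t)
    (hut : ∀ t ∈ Ioo 0 T, HasDerivAt ut (-((q t : ℂ) * u t)) t) : ContinuousOn ut (Icc 0 T) := by
  obtain ⟨B, hB⟩ := isCompact_Icc.exists_bound_of_continuousOn
    (f := u) (s := Icc 0 T) fun t ht => (hu t ht).continuousWithinAt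
  refine continuousOn_of_hasDerivWithinAt_of_lipschitzOnWith hT (K := (Q * B).toNNReal) hu ?_
  refine (convex_Ioo 0 T).lipschitzOnWith_of_nnnorm_hasDerivWithin_le
    (fun t ht => (hut t ht).hasDerivWithinAt) fun t ht => ?_
  rw [← NNReal.coe_le_coe, coe_nnnorm, norm_neg, norm_mul, Complex.norm_real, Real.norm_eq_abs]
  refine le_trans ?_ (Real.le_coe_toNNReal _)
  exact mul_le_mul (hQ t ht) (hB t (Ioo_subset_Icc_self ht)) (norm_nonneg _)
    ((abs_nonneg _).trans (hQ t ht))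

/-- The energy estimate at frequency `1`, where `|1 - q| ≤ 1 + Q`, starts from zero energy. -/
theorem ode_solution_eq_zero (hT : 0 < T) (hQ : ∀ t ∈ Ioo 0 T, |q t| ≤ Q) {u ut : ℝ → ℂ}
    (hu : ∀ t ∈ Icc 0 T, HasDerivWithinAt u (ut t) (Icc 0 T) t)
    (hut : ∀ t ∈ Ioo 0 T, HasDerivAt ut (-((q t : ℂ) * u t)) t)
    (h0 : u 0 = 0) (h1 : ut 0 = 0) {t : ℝ} (ht : t ∈ Icc 0 T) : u t = 0 ∧ ut t = 0 := by
  have key := energy_le_exp (u := u) (ut := ut) (q := q) (l := 1) (K := 1 + Q) one_pos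
    (fun t ht => (hu t ht).continuousWithinAt) (continuousOn_deriv_of_ode hT hQ hu hut)
    (fun t ht => (hu t (Ioo_subset_Icc_self ht)).hasDerivAt (Icc_mem_nhds ht.1 ht.2))
    (fun t ht => by simpa using hut t ht) (fun t ht => by
      have := hQ t ht
      rw [abs_le] at this ⊢
      constructor <;> linarith) ht
  simp only [h0, h1, norm_zero] at key
  norm_num at key
  have h2 : ‖u t‖ ^ 2 = 0 := by nlinarith [sq_nonneg ‖u t‖, sq_nonneg ‖ut t‖]
  have h3 : ‖ut t‖ ^ 2 = 0 := by nlinarith [sq_nonneg ‖u t‖, sq_nonneg ‖ut t‖]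
  simpa using And.intro h2 h3

/-- Integration against the weight `exp (K r)` gains a factor `1 / K`, which lets a Picard map
contract on all of `[0,T]` at once. -/
theorem norm_integral_le_of_norm_le_exp {f : ℝ → ℂ} {K C s : ℝ} (hK : 0 < K) (hs : 0 ≤ s)
    (hC : 0 ≤ C) (hf : ∀ r ∈ Ioc 0 s, ‖f r‖ ≤ C * Real.exp (K * r)) :
    ‖∫ r in (0 : ℝ)..s, f r‖ ≤ C / K * Real.exp (K * s) := by
  refine (intervalIntegral.norm_integral_le_of_norm_le hs (ae_of_all _ hf)
    (Continuous.intervalIntegrable (by fun_prop) _ _)).trans ?_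
  rw [intervalIntegral.integral_const_mul, intervalIntegral.integral_comp_mul_left _ hK.ne',
    integral_exp, mul_zero, Real.exp_zero, smul_eq_mul, div_mul_eq_mul_div, mul_div_assoc,
    inv_mul_eq_div]
  gcongr
  linarith

/-- Existence for `u'' + q u = 0` on `[0,T]` with `q` bounded and continuous on `(0,T]`. -/
theorem exists_ode_solution (hT : 0 < T) (hq : ContinuousOn q (Ioc 0 T))
    (hQ : ∀ t ∈ Ioc 0 T, |q t| ≤ Q) (x₀ x₁ : ℂ) :
    ∃ u ut : ℝ → ℂ, u 0 = x₀ ∧ ut 0 = x₁ ∧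
      (∀ t ∈ Icc 0 T, HasDerivWithinAt u (ut t) (Icc 0 T) t) ∧
      ∀ t ∈ Ioo 0 T, HasDerivAt ut (-((q t : ℂ) * u t)) t := by
  have hQ0 : 0 ≤ Q := (abs_nonneg _).trans (hQ T ⟨hT, le_rfl⟩)
  -- Only the values of `q` on `(0,T]` are controlled; extension by zero gives a bounded measurable
  -- coefficient on the line.
  set p : ℝ → ℝ := (Ioc 0 T).indicator q with hp
  have hpm : AEStronglyMeasurable p volume :=
    (aestronglyMeasurable_indicator_iff measurableSet_Ioc).2
      (hq.aestronglyMeasurable measurableSet_Ioc)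
  have hpQ : ∀ t, |p t| ≤ Q := fun t => by
    by_cases ht : t ∈ Ioc 0 T
    · simpa [hp, ht] using hQ t ht
    · simpa [hp, ht] using hQ0
  -- The Picard map acts on `z = exp (-K t) u`. Its two integrations give the Lipschitz constant `Q
  -- / K²`, at most `1 / 2` for this `K`.
  set K : ℝ := 2 * Q + 1 with hK
  have hK0 : 0 < K := by positivity
  have hint : ∀ g : ℝ → ℂ, Continuous g → ∀ a b,
      IntervalIntegrable (fun r => (p r : ℂ) * g r) volume a b := fun g hg a b => by
    rw [intervalIntegrable_iff]
    refine ((hg.integrableOn_Icc (a := min a b) (b := max a b)).mono_set Ioc_subset_Icc_self).bdd_mul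
      (c := Q) ?_ (ae_of_all _ fun t => by simpa using hpQ t)
    exact (Complex.continuous_ofReal.comp_aestronglyMeasurable hpm).restrict
  let G : C(Icc 0 T, ℂ) → ℝ → ℂ := fun z r => Real.exp (K * r) * IccExtend hT.le z r
  have hG : ∀ z, Continuous (G z) := fun z => by
    have : Continuous (IccExtend hT.le z) := z.continuous.Icc_extend'
    fun_prop
  let U' : C(Icc 0 T, ℂ) → ℝ → ℂ := fun z s => x₁ - ∫ r in (0 : ℝ)..s, (p r : ℂ) * G z r
  have hU' : ∀ z, Continuous (U' z) := fun z =>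
    continuous_const.sub (intervalIntegral.continuous_primitive (hint _ (hG z)) 0)
  let U : C(Icc 0 T, ℂ) → ℝ → ℂ := fun z t => x₀ + ∫ s in (0 : ℝ)..t, U' z s
  have hU : ∀ z, Continuous (U z) := fun z => continuous_const.add
    (intervalIntegral.continuous_primitive (fun a b => (hU' z).intervalIntegrable a b) 0)
  let W : C(Icc 0 T, ℂ) → C(Icc 0 T, ℂ) := fun z =>
    ⟨fun t => Real.exp (-(K * t)) * U z t, by have := hU z; fun_prop⟩
  have hW : ContractingWith (1 / 2 : ℝ≥0) W := by
    refine ⟨by norm_num, LipschitzWith.of_dist_le_mul fun z z' => ?_⟩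
    have hD : ∀ r, ‖IccExtend hT.le z r - IccExtend hT.le z' r‖ ≤ dist z z' := fun r => by
      rw [← dist_eq_norm]; exact ContinuousMap.dist_apply_le_dist _
    have h1 : ∀ s, 0 ≤ s → ‖U' z s - U' z' s‖ ≤ Q * dist z z' / K * Real.exp (K * s) := by
      intro s hs
      have e : U' z s - U' z' s = ∫ r in (0 : ℝ)..s, (p r : ℂ) * (G z' r - G z r) := by
        simp only [U', mul_sub]
        rw [intervalIntegral.integral_sub (hint _ (hG z') _ _) (hint _ (hG z) _ _)]
        ring
      rw [e]
      refine norm_integral_le_of_norm_le_exp hK0 hs (by positivity) fun r _ => ?_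
      have e2 : G z' r - G z r = Real.exp (K * r) *
          (IccExtend hT.le z' r - IccExtend hT.le z r) := by simp only [G]; ring
      rw [e2, norm_mul, norm_mul, Complex.norm_real, Complex.norm_real, Real.norm_eq_abs,
        Real.norm_eq_abs, Real.abs_exp, norm_sub_rev]
      calc |p r| * (Real.exp (K * r) * ‖IccExtend hT.le z r - IccExtend hT.le z' r‖)
          ≤ Q * (Real.exp (K * r) * dist z z') := by
            gcongr
            exacts [hpQ r, hD r]
        _ = _ := by ring
    have h2 : ∀ t, 0 ≤ t → ‖U z t - U z' t‖ ≤ Q * dist z z' / K / K * Real.exp (K * t) := by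
      intro t ht
      have e : U z t - U z' t = ∫ s in (0 : ℝ)..t, (U' z s - U' z' s) := by
        rw [intervalIntegral.integral_sub ((hU' z).intervalIntegrable _ _)
          ((hU' z').intervalIntegrable _ _)]
        simp only [U]
        ring
      rw [e]
      exact norm_integral_le_of_norm_le_exp hK0 ht (by positivity) fun r hr => h1 r hr.1.le
    rw [ContinuousMap.dist_le (by positivity)]
    intro t
    have e : dist (W z t) (W z' t) = Real.exp (-(K * t)) * ‖U z t - U z' t‖ := by
      rw [dist_eq_norm]
      simp only [W, ContinuousMap.coe_mk]
      rw [← mul_sub, norm_mul, Complex.norm_real, Real.norm_eq_abs, Real.abs_exp]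
    rw [e]
    calc Real.exp (-(K * t)) * ‖U z t - U z' t‖
        ≤ Real.exp (-(K * t)) * (Q * dist z z' / K / K * Real.exp (K * t)) := by
          gcongr
          exact h2 t t.2.1
      _ = Q / (K * K) * dist z z' := by
          rw [Real.exp_neg]
          field_simp
      _ ≤ _ := by
          gcongr
          push_cast
          rw [div_le_div_iff₀ (by positivity) two_pos]
          nlinarith
  set z := ContractingWith.fixedPoint W hW
  have hz : W z = z := hW.fixedPoint_isFixedPt
  have hUG : ∀ t ∈ Icc 0 T, G z t = U z t := fun t ht => by
    have : W z ⟨t, ht⟩ = z ⟨t, ht⟩ := by rw [hz]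
    simp only [G, IccExtend_of_mem _ _ ht, ← this, W, ContinuousMap.coe_mk]
    rw [← mul_assoc, ← Complex.ofReal_mul, ← Real.exp_add]
    simp
  refine ⟨U z, U' z, by simp [U], by simp [U'], fun t _ => ?_, fun t ht => ?_⟩
  · exact ((intervalIntegral.integral_hasDerivAt_right ((hU' z).intervalIntegrable _ _)
      ((hU' z).stronglyMeasurableAtFilter _ _) (hU' z).continuousAt).const_add x₀).hasDerivWithinAt
  · have hpt : ContinuousAt p t := by
      refine ((hq t (Ioo_subset_Ioc_self ht)).continuousAt (Ioc_mem_nhds ht.1 ht.2)).congr ?_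
      filter_upwards [Ioc_mem_nhds ht.1 ht.2] with r hr
      simp [hp, hr]
    have h3 := (intervalIntegral.integral_hasDerivAt_right (hint _ (hG z) 0 t)
      (AEStronglyMeasurable.stronglyMeasurableAtFilter
        ((Complex.continuous_ofReal.comp_aestronglyMeasurable hpm).mul
          (hG z).aestronglyMeasurable))
      ((Complex.continuous_ofReal.continuousAt.comp hpt).mul (hG z).continuousAt)).const_sub x₁
    refine h3.congr_deriv ?_
    rw [← hUG t (Ioo_subset_Icc_self ht)]
    simp [hp, Ioo_subset_Ioc_self ht]

end LinearODE

end

/-! ### The two zones in time and the resulting loss. -/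

section

section Zones

variable {T C₄ : ℝ} {ν : ℝ → ℝ}

/-- Intermediate value theorem: since `ν ≥ C₄`, the quotient `t / ν t` is at most `r` at `t = min T
(C₄ r)`. -/
theorem exists_div_eq (hνc : ContinuousOn ν (Ioc 0 T)) (hC₄ : 0 < C₄)
    (hν : ∀ t ∈ Ioc 0 T, C₄ ≤ ν t) {r : ℝ} (hr : 0 < r) (hT : 0 < T) (hrT : r ≤ T / ν T) :
    ∃ t ∈ Ioc 0 T, t / ν t = r := by
  set ε := min T (C₄ * r) with hε
  have hε0 : 0 < ε := lt_min hT (mul_pos hC₄ hr)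
  have hεT : ε ≤ T := min_le_left _ _
  have hsub : Icc ε T ⊆ Ioc 0 T := fun t ht => ⟨hε0.trans_le ht.1, ht.2⟩
  have hc : ContinuousOn (fun t => t / ν t) (Icc ε T) :=
    continuousOn_id.div (hνc.mono hsub) fun t ht => (hC₄.trans_le (hν t (hsub ht))).ne'
  have hεr : ε / ν ε ≤ r := by
    have h1 := hν ε ⟨hε0, hεT⟩
    rw [div_le_iff₀ (hC₄.trans_le h1)]
    calc ε ≤ C₄ * r := min_le_right _ _
      _ ≤ r * ν ε := by rw [mul_comm]; gcongr
  obtain ⟨t, ht, htr⟩ := intermediate_value_Icc hεT hc ⟨hεr, hrT⟩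
  exact ⟨t, hsub ht, htr⟩

/-- The second alternative is the default value `T`, taken for frequencies so low that the first
zone is the whole interval. -/
theorem muInv_spec (hνc : ContinuousOn ν (Ioc 0 T)) (hC₄ : 0 < C₄)
    (hν : ∀ t ∈ Ioc 0 T, C₄ ≤ ν t) {r : ℝ} (hr : 0 < r) (hT : 0 < T) :
    muInv T ν r ∈ Ioc 0 T ∧ (muInv T ν r / ν (muInv T ν r) = r ∨
      (muInv T ν r = T ∧ T / ν T < r)) := by
  unfold muInv
  split_ifs with h
  · have hex := exists_div_eq hνc hC₄ hν hr hT h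
    exact ⟨Function.invFunOn_mem hex, Or.inl (Function.invFunOn_eq hex)⟩
  · exact ⟨⟨hT, le_rfl⟩, Or.inr ⟨rfl, not_le.1 h⟩⟩

/-- The loss rate `c₁` as a function of `C₁, C₂, C₃` and of the zone constant `M = 2^P`. -/
noncomputable def lossRate (C₁ C₂ C₃ M : ℝ) : ℝ :=
  (1 + C₂ ^ 2) * M + (C₃ / C₁ ^ 2 + 2 * C₃ ^ 2 / C₁ ^ 3) / M

/-- The energy of the solution of frequency `l` at time `t` is bounded by its initial energy up to
the factor `exp(c₁ ν(μ⁻¹(2^P / l)))`. -/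
theorem energy_le_loss {C₁ C₂ C₃ : ℝ} (hC₁ : 0 < C₁) (hC₂ : 0 < C₂) (hC₃ : 0 < C₃) {P : ℕ}
    (hP : C₃ / C₁ ^ 2 ≤ 2 ^ P) (hT : 0 < T) (hνc : ContinuousOn ν (Ioc 0 T))
    (hνa : StrictAntiOn ν (Ioc 0 T)) (hC₄ : 0 < C₄) (hν : ∀ t ∈ Ioc 0 T, C₄ ≤ ν t)
    {b : ℝ → ℝ} (hb : ∀ t ∈ Ioc 0 T, C₁ ≤ b t ∧ b t ≤ C₂) (hbd : ContDiffOn ℝ 2 b (Ioc 0 T))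
    (hbk : ∀ k ∈ ({1, 2} : Set ℕ), ∀ t ∈ Ioc 0 T,
      |iteratedDerivWithin k b (Ioc 0 T) t| ≤ C₃ * (ν t / t) ^ k)
    {l : ℝ} (hl : 0 < l) {F : Type*} [NormedAddCommGroup F] [InnerProductSpace ℝ F]
    {u ut : ℝ → F} (hu : ContinuousOn u (Icc 0 T)) (hut : ContinuousOn ut (Icc 0 T))
    (hu' : ∀ t ∈ Ioo 0 T, HasDerivAt u (ut t) t)
    (hut' : ∀ t ∈ Ioo 0 T, HasDerivAt ut (-((b t ^ 2 * l ^ 2) • u t)) t)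
    {t : ℝ} (ht : t ∈ Icc 0 T) :
    l ^ 2 * ‖u t‖ ^ 2 + ‖ut t‖ ^ 2 ≤ (1 + 3 * (C₂ + 1 / C₁) ^ 2) *
      Real.exp (lossRate C₁ C₂ C₃ (2 ^ P) * ν (muInv T ν (2 ^ P / l))) *
      (l ^ 2 * ‖u 0‖ ^ 2 + ‖ut 0‖ ^ 2) := by
  obtain ⟨hα, hαs⟩ := muInv_spec hνc hC₄ hν (r := 2 ^ P / l) (by positivity) hT
  set α := muInv T ν (2 ^ P / l)
  set n := ν α with hn
  set M : ℝ := 2 ^ P with hM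
  have hM0 : 0 < M := by positivity
  have hn0 : 0 < n := hC₄.trans_le (hν α hα)
  -- Equality when `α` solves `μ(α) = M / l`. At the default value only the inequality remains, and
  -- the first zone needs no more.
  have hlα : l * α ≤ M * n := by
    rcases hαs with h | ⟨h, h'⟩
    · rw [div_eq_iff hn0.ne'] at h
      rw [h]
      exact le_of_eq (by field_simp)
    · rw [← h, div_lt_iff₀ hn0, div_mul_eq_mul_div, lt_div_iff₀ hl] at h'
      linarith
  set K := C₃ / C₁ ^ 2 + 2 * C₃ ^ 2 / C₁ ^ 3 with hK
  have hK0 : 0 ≤ K := by positivity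
  set a := C₂ + 1 / C₁ with ha
  have ha0 : 0 < a := by positivity
  set E : ℝ → ℝ := fun t => l ^ 2 * ‖u t‖ ^ 2 + ‖ut t‖ ^ 2 with hE
  have hE0 : ∀ t, 0 ≤ E t := fun t => by positivity
  have hq : ∀ t ∈ Ioc 0 T, |l ^ 2 - b t ^ 2 * l ^ 2| ≤ (1 + C₂ ^ 2) * l ^ 2 := fun t ht => by
    obtain ⟨h1, h2⟩ := hb t ht
    have h3 : b t ^ 2 ≤ C₂ ^ 2 := by have := hC₁.trans_le h1; gcongr
    have h4 : 0 ≤ b t ^ 2 * l ^ 2 := by positivity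
    have h5 : b t ^ 2 * l ^ 2 ≤ C₂ ^ 2 * l ^ 2 := by gcongr
    rw [abs_le]
    constructor <;> nlinarith [sq_nonneg l]
  have zone1 : ∀ t ∈ Icc 0 α, E t ≤ E 0 * Real.exp ((1 + C₂ ^ 2) * M * n) := fun t ht => by
    have hsub : Icc 0 α ⊆ Icc 0 T := Icc_subset_Icc_right hα.2
    have hsub' : Ioo 0 α ⊆ Ioo 0 T := Ioo_subset_Ioo_right hα.2
    refine (energy_le_exp (q := fun t => b t ^ 2 * l ^ 2) hl (hu.mono hsub) (hut.mono hsub)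
      (fun t ht => hu' t (hsub' ht)) (fun t ht => hut' t (hsub' ht))
      (fun t ht => hq t (Ioo_subset_Ioc_self (hsub' ht))) ht).trans ?_
    have h1 : (1 + C₂ ^ 2) * l * (t - 0) ≤ (1 + C₂ ^ 2) * M * n := by
      have : l * t ≤ M * n := le_trans (by have := ht.2; gcongr) hlα
      rw [sub_zero, mul_assoc, mul_assoc]
      gcongr
    have := hE0 0
    gcongr
  have hrate : lossRate C₁ C₂ C₃ M * n = (1 + C₂ ^ 2) * M * n + K / M * n := by
    rw [lossRate, ← hK]; ring
  rcases le_or_gt t α with htα | htα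
  · calc E t ≤ E 0 * Real.exp ((1 + C₂ ^ 2) * M * n) := zone1 t ⟨ht.1, htα⟩
      _ ≤ E 0 * ((1 + 3 * a ^ 2) * Real.exp (lossRate C₁ C₂ C₃ M * n)) := by
          have h1 : Real.exp ((1 + C₂ ^ 2) * M * n) ≤ Real.exp (lossRate C₁ C₂ C₃ M * n) := by
            have : 0 ≤ K / M * n := by positivity
            rw [hrate]; gcongr; linarith
          have h2 : 1 ≤ 1 + 3 * a ^ 2 := by nlinarith [sq_nonneg a]
          have := hE0 0
          gcongr
          exact h1.trans (le_mul_of_one_le_left (Real.exp_pos _).le h2)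
      _ = _ := by ring
  -- A time beyond `α` rules out `α = T`, hence the default value.
  · have hαeq : α / n = M / l := by
      rcases hαs with h | ⟨h, -⟩
      · exact h
      · exact absurd ht.2 (not_le.2 (h ▸ htα))
    have hlα' : l * α = M * n := by field_simp at hαeq; linarith
    have hsub : Icc α T ⊆ Ioc 0 T := fun τ hτ => ⟨hα.1.trans_le hτ.1, hτ.2⟩
    have hsubI : Icc α T ⊆ Icc 0 T := hsub.trans Ioc_subset_Icc_self
    have hsub' : Ioo α T ⊆ Ioo 0 T := Ioo_subset_Ioo_left hα.1.le
    have hS : UniqueDiffOn ℝ (Ioc 0 T) := uniqueDiffOn_Ioc 0 T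
    have hνl : ∀ τ ∈ Icc α T, ν τ ≤ n := fun τ hτ => hνa.antitoneOn hα (hsub hτ) hτ.1
    have hν0 : ∀ τ ∈ Icc α T, 0 < ν τ := fun τ hτ => hC₄.trans_le (hν τ (hsub hτ))
    have hz2 := adiabatic_energy_le (u := u) (ut := ut) (b := b)
      (b' := iteratedDerivWithin 1 b (Ioc 0 T)) (b'' := iteratedDerivWithin 2 b (Ioc 0 T))
      (m := fun t => ν t / t) (α := α) (β := T) (n := n) (C₃ := C₃) (M := M)
      hα.1 hl hC₁ hM0 hP (hu.mono hsubI) (hut.mono hsubI)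
      (fun t ht => hu' t (hsub' ht)) (fun t ht => hut' t (hsub' ht))
      (hbd.continuousOn.mono hsub)
      ((hbd.continuousOn_iteratedDerivWithin (by norm_num) hS).mono hsub)
      (fun τ hτ => ?_) (fun τ hτ => ?_) (fun τ hτ => (hb τ (hsub hτ)).1)
      (fun τ hτ => by simpa using hbk 1 (by simp) τ (hsub hτ))
      (fun τ hτ => hbk 2 (by simp) τ (hsub hτ))
      (fun τ hτ => (div_pos (hν0 τ hτ) (hsub hτ).1).le)
      (fun τ hτ => by have := hνl τ hτ; have := (hsub hτ).1; gcongr)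
      (fun τ hτ => ?_) hC₃.le (t := t) ⟨htα.le, ht.2⟩
    · have hup : E t ≤ a * (‖ut t‖ ^ 2 / b t + b t * l ^ 2 * ‖u t‖ ^ 2) := by
        obtain ⟨h1, h2⟩ := hb t ⟨hα.1.trans htα, ht.2⟩
        have h0 : 0 < b t := hC₁.trans_le h1
        have e1 : ‖ut t‖ ^ 2 ≤ C₂ * (‖ut t‖ ^ 2 / b t) := by
          rw [mul_div_assoc', le_div_iff₀ h0]; nlinarith [sq_nonneg ‖ut t‖]
        have e2 : l ^ 2 * ‖u t‖ ^ 2 ≤ 1 / C₁ * (b t * l ^ 2 * ‖u t‖ ^ 2) := by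
          rw [div_mul_eq_mul_div, le_div_iff₀ hC₁, one_mul]
          have : 0 ≤ l ^ 2 * ‖u t‖ ^ 2 := by positivity
          nlinarith
        have e3 : 0 ≤ C₂ * (b t * l ^ 2 * ‖u t‖ ^ 2) := by positivity
        have e4 : 0 ≤ 1 / C₁ * (‖ut t‖ ^ 2 / b t) := by positivity
        simp only [hE, ha]
        linarith
      have hlo : ‖ut α‖ ^ 2 / b α + b α * l ^ 2 * ‖u α‖ ^ 2 ≤ a * E α := by
        obtain ⟨h1, h2⟩ := hb α hα
        have h0 : 0 < b α := hC₁.trans_le h1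
        have e1 : ‖ut α‖ ^ 2 / b α ≤ 1 / C₁ * ‖ut α‖ ^ 2 := by
          rw [div_mul_eq_mul_div, one_mul]; gcongr
        have e2 : b α * l ^ 2 * ‖u α‖ ^ 2 ≤ C₂ * (l ^ 2 * ‖u α‖ ^ 2) := by
          rw [mul_assoc]; gcongr
        have e3 : 0 ≤ C₂ * ‖ut α‖ ^ 2 := by positivity
        have e4 : 0 ≤ 1 / C₁ * (l ^ 2 * ‖u α‖ ^ 2) := by positivity
        simp only [hE, ha]
        linarith
      have hexp : K * n ^ 2 / (l * α) = K / M * n := by rw [hlα']; field_simp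
      rw [hexp] at hz2
      have h0 := hE0 0
      -- Each passage between the plain and the adiabatic energy costs a factor `a`; the exponents
      -- of the two zones add up to the loss rate times `n`.
      calc E t ≤ a * (3 * (a * (E 0 * Real.exp ((1 + C₂ ^ 2) * M * n))) *
              Real.exp (K / M * n)) := by
            refine hup.trans ?_
            gcongr
            refine hz2.trans ?_
            gcongr
            refine hlo.trans ?_
            gcongr
            exact zone1 α ⟨hα.1.le, le_rfl⟩
        _ = 3 * a ^ 2 * Real.exp (lossRate C₁ C₂ C₃ M * n) * E 0 := by
            rw [hrate, Real.exp_add]; ring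
        _ ≤ _ := by gcongr; linarith
    · have hnh : Ioc 0 T ∈ 𝓝 τ := Ioc_mem_nhds (hsub' hτ).1 (hsub' hτ).2
      have := ((hbd.differentiableOn (by norm_num)) τ
        (Ioo_subset_Ioc_self (hsub' hτ))).hasDerivWithinAt.hasDerivAt hnh
      rwa [← iteratedDerivWithin_one] at this
    · have hnh : Ioc 0 T ∈ 𝓝 τ := Ioc_mem_nhds (hsub' hτ).1 (hsub' hτ).2
      have := ((hbd.differentiableOn_iteratedDerivWithin (m := 1) (by norm_num) hS) τ
        (Ioo_subset_Ioc_self (hsub' hτ))).hasDerivWithinAt.hasDerivAt hnh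
      rwa [← iteratedDerivWithin_succ] at this
    -- Monotonicity of `ν` gives `ν τ / τ ≤ ν α / α = l / M` for `τ ≥ α`.
    · have e : l / M = n / α := by
        have := hα.1
        field_simp; linarith
      rw [e]
      have h1 := hνl τ hτ
      have h2 := hα.1
      have h3 := hτ.1
      exact div_le_div₀ hn0.le h1 h2 h3

end Zones

/-! ### Continuity in time from bounds on the coefficients. -/

namespace Eigenbasis

variable {N : ℕ} {Ω : Set (EuclideanSpace ℝ (Fin N))}
  {A : EuclideanSpace ℝ (Fin N) → EuclideanSpace ℝ (Fin N)} (Φ : Eigenbasis Ω A)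

/-- Dominated convergence for the series over `k`: the majorant `B` is independent of `t`, so
continuity of each coefficient suffices. -/
theorem continuousInSobolev_of_le {T s : ℝ} {v : ℝ → ℕ → ℂ} {B : ℕ → ℝ} (hB : Summable B)
    (hv : ∀ k, ContinuousOn (fun t => v t k) (Icc 0 T))
    (hvB : ∀ k, ∀ t ∈ Icc 0 T, Φ.lam k ^ (2 * s) * ‖v t k‖ ^ 2 ≤ B k) :
    Φ.ContinuousInSobolev T s v := by
  have hl : ∀ k, 0 ≤ Φ.lam k ^ (2 * s) := fun k => Real.rpow_nonneg (Φ.lam_pos k).le _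
  refine ⟨fun t ht => Summable.of_nonneg_of_le (fun k => mul_nonneg (hl k) (sq_nonneg _))
    (fun k => hvB k t ht) hB, fun t ht => ?_⟩
  suffices h : Tendsto (fun τ => Φ.sobolevNormSq s (v τ - v t)) (𝓝[Icc 0 T] t)
      (𝓝 (∑' _ : ℕ, (0 : ℝ))) by simpa using h
  refine tendsto_tsum_of_dominated_convergence (bound := fun k => 4 * B k) (hB.mul_left 4)
    (fun k => ?_) ?_
  · have h1 : Tendsto (fun τ => Φ.lam k ^ (2 * s) * ‖v τ k - v t k‖ ^ 2) (𝓝[Icc 0 T] t)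
        (𝓝 (Φ.lam k ^ (2 * s) * ‖v t k - v t k‖ ^ 2)) :=
      (((hv k t ht).tendsto.sub_const _).norm.pow 2).const_mul _
    simpa using h1
  · filter_upwards [self_mem_nhdsWithin] with τ hτ k
    rw [Real.norm_of_nonneg (mul_nonneg (hl k) (sq_nonneg _)), Pi.sub_apply]
    have h1 : ‖v τ k - v t k‖ ^ 2 ≤ 2 * ‖v τ k‖ ^ 2 + 2 * ‖v t k‖ ^ 2 := by
      have h2 := norm_sub_le (v τ k) (v t k)
      nlinarith [norm_nonneg (v τ k - v t k), norm_nonneg (v τ k), norm_nonneg (v t k),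
        sq_nonneg (‖v τ k‖ - ‖v t k‖)]
    have h3 := mul_le_mul_of_nonneg_left h1 (hl k)
    linarith [hvB k τ hτ, hvB k t ht]

theorem continuousInImage_of_le {T s : ℝ} {u : ℝ → ℕ → ℂ} {B : ℕ → ℝ} {F : ℝ → ℝ}
    (hF : ∀ l, 0 < F l) (hB : Summable B) (hu : ∀ k, ContinuousOn (fun t => u t k) (Icc 0 T))
    (huB : ∀ k, ∀ t ∈ Icc 0 T, Φ.lam k ^ (2 * s) * ‖u t k‖ ^ 2 ≤ F (Φ.lam k) ^ 2 * B k) :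
    Φ.ContinuousInImage F T s u := by
  refine ⟨fun t k => (F (Φ.lam k) : ℂ)⁻¹ * u t k, Φ.continuousInSobolev_of_le hB
    (fun k => continuousOn_const.mul (hu k)) fun k t ht => ?_, fun t ht => ?_⟩
  · have h0 := hF (Φ.lam k)
    rw [norm_mul, norm_inv, Complex.norm_real, Real.norm_of_nonneg h0.le, mul_pow, inv_pow,
      mul_left_comm, inv_mul_le_iff₀ (by positivity)]
    exact huB k t ht
  · funext k
    have h0 : (F (Φ.lam k) : ℂ) ≠ 0 := by exact_mod_cast (hF (Φ.lam k)).ne'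
    simp only [fn]
    rw [mul_inv_cancel_left₀ h0]

end Eigenbasis

end

/-! ### Solvability for a given eigenbasis. -/

section

namespace Eigenbasis

variable {N : ℕ} {Ω : Set (EuclideanSpace ℝ (Fin N))}
  {A : EuclideanSpace ℝ (Fin N) → EuclideanSpace ℝ (Fin N)} (Φ : Eigenbasis Ω A)

/-- Solvability and finite or infinite loss of regularity, for a given eigenbasis. -/
theorem exists_isSolution {C₁ C₂ C₃ : ℝ} (hC₁ : 0 < C₁) (hC₂ : 0 < C₂) (hC₃ : 0 < C₃) {P : ℕ}
    (hP : C₃ / C₁ ^ 2 ≤ 2 ^ P) {T : ℝ} (hT : 0 < T) {ν : ℝ → ℝ} (hνc : ContinuousOn ν (Ioc 0 T))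
    (hνa : StrictAntiOn ν (Ioc 0 T)) {C₄ : ℝ} (hC₄ : 0 < C₄) (hν : ∀ t ∈ Ioc 0 T, C₄ ≤ ν t)
    {b : ℝ → ℝ} (hb : ∀ t ∈ Ioc 0 T, C₁ ≤ b t ∧ b t ≤ C₂) (hbd : ContDiffOn ℝ 2 b (Ioc 0 T))
    (hbk : ∀ k ∈ ({1, 2} : Set ℕ), ∀ t ∈ Ioc 0 T,
      |iteratedDerivWithin k b (Ioc 0 T) t| ≤ C₃ * (ν t / t) ^ k)
    {s : ℝ} {u₀ u₁ : L2 Ω} (hu₀ : Φ.MemSobolev s (Φ.coeff u₀))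
    (hu₁ : Φ.MemSobolev (s - 1) (Φ.coeff u₁)) :
    ∃ u ut : ℝ → ℕ → ℂ, Φ.IsSolution T b u₀ u₁ u ut ∧
      Φ.ContinuousInImage (lossSymbol T ν P (lossRate C₁ C₂ C₃ (2 ^ P))) T s u ∧
      Φ.ContinuousInImage (lossSymbol T ν P (lossRate C₁ C₂ C₃ (2 ^ P))) T (s - 1) ut ∧
      ∀ w wt : ℝ → ℕ → ℂ, Φ.IsSolution T b u₀ u₁ w wt →
        ∀ t ∈ Icc 0 T, w t = u t ∧ wt t = ut t := by
  have hqQ : ∀ k, ∀ t ∈ Ioc 0 T, |b t ^ 2 * Φ.lam k ^ 2| ≤ C₂ ^ 2 * Φ.lam k ^ 2 := by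
    intro k t ht
    obtain ⟨h1, h2⟩ := hb t ht
    rw [abs_of_nonneg (by positivity)]
    have := hC₁.trans_le h1
    gcongr
  have hqc : ∀ k, ContinuousOn (fun t => b t ^ 2 * Φ.lam k ^ 2) (Ioc 0 T) := fun k =>
    (hbd.continuousOn.pow 2).mul continuousOn_const
  choose u ut hu0 hut0 hu hut using fun k =>
    exists_ode_solution hT (hqc k) (hqQ k) (Φ.coeff u₀ k) (Φ.coeff u₁ k)
  have hQo : ∀ k, ∀ t ∈ Ioo 0 T, |b t ^ 2 * Φ.lam k ^ 2| ≤ C₂ ^ 2 * Φ.lam k ^ 2 :=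
    fun k t ht => hqQ k t (Ioo_subset_Ioc_self ht)
  have huc : ∀ k, ContinuousOn (u k) (Icc 0 T) := fun k t ht => (hu k t ht).continuousWithinAt
  have hutc : ∀ k, ContinuousOn (ut k) (Icc 0 T) := fun k =>
    continuousOn_deriv_of_ode hT (hQo k) (hu k) (hut k)
  have hF : ∀ l, 0 < lossSymbol T ν P (lossRate C₁ C₂ C₃ (2 ^ P)) l := fun l => Real.exp_pos _
  set D := 1 + 3 * (C₂ + 1 / C₁) ^ 2 with hD
  have hD0 : 0 < D := by positivity
  have hE : ∀ k, ∀ t ∈ Icc 0 T, Φ.lam k ^ 2 * ‖u k t‖ ^ 2 + ‖ut k t‖ ^ 2 ≤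
      lossSymbol T ν P (lossRate C₁ C₂ C₃ (2 ^ P)) (Φ.lam k) ^ 2 *
        (D * (Φ.lam k ^ 2 * ‖Φ.coeff u₀ k‖ ^ 2 + ‖Φ.coeff u₁ k‖ ^ 2)) := fun k t ht => by
    have h1 := energy_le_loss hC₁ hC₂ hC₃ hP hT hνc hνa hC₄ hν hb hbd hbk (Φ.lam_pos k)
      (huc k) (hutc k)
      (fun t ht => (hu k t (Ioo_subset_Icc_self ht)).hasDerivAt (Icc_mem_nhds ht.1 ht.2))
      (fun t ht => by simpa using hut k t ht) ht
    rw [hu0, hut0] at h1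
    refine h1.trans ?_
    have hα := (muInv_spec hνc hC₄ hν (r := 2 ^ P / Φ.lam k)
      (div_pos (by positivity) (Φ.lam_pos k)) hT).1
    have hn := hC₄.trans_le (hν _ hα)
    have hr : 0 ≤ lossRate C₁ C₂ C₃ (2 ^ P) := by unfold lossRate; positivity
    -- Amplitudes enter squared, so the target is the square of the symbol; the exponent being
    -- nonnegative, the symbol is at most its square.
    have h2 : lossSymbol T ν P (lossRate C₁ C₂ C₃ (2 ^ P)) (Φ.lam k) ≤
        lossSymbol T ν P (lossRate C₁ C₂ C₃ (2 ^ P)) (Φ.lam k) ^ 2 :=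
      le_self_pow₀ (Real.one_le_exp (mul_nonneg hr hn.le)) two_ne_zero
    rw [← hD, mul_comm D, mul_assoc]
    exact mul_le_mul_of_nonneg_right h2 (by positivity)
  have hpow : ∀ k, Φ.lam k ^ (2 * s) = Φ.lam k ^ (2 * (s - 1)) * Φ.lam k ^ 2 := fun k => by
    rw [← Real.rpow_natCast, ← Real.rpow_add (Φ.lam_pos k)]
    congr 1
    push_cast
    ring
  -- One majorant serves both `u` in `H^s` and `u_t` in `H^(s-1)`, since the energy weights `u` by
  -- `λ²`.
  have hB : Summable fun k => Φ.lam k ^ (2 * (s - 1)) *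
      (D * (Φ.lam k ^ 2 * ‖Φ.coeff u₀ k‖ ^ 2 + ‖Φ.coeff u₁ k‖ ^ 2)) := by
    refine ((hu₀.add hu₁).mul_left D).congr fun k => ?_
    rw [hpow]
    ring
  have hl : ∀ k, 0 ≤ Φ.lam k ^ (2 * (s - 1)) := fun k => Real.rpow_nonneg (Φ.lam_pos k).le _
  refine ⟨fun t k => u k t, fun t k => ut k t, ⟨funext hu0, funext hut0, hu, fun k t ht => ?_⟩,
    Φ.continuousInImage_of_le hF hB huc fun k t ht => ?_,
    Φ.continuousInImage_of_le hF hB hutc fun k t ht => ?_, fun w wt hw t ht => ?_⟩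
  · refine (hut k t ht).congr_deriv ?_
    simp only [fn]
    push_cast
    ring
  · rw [hpow, mul_assoc, mul_left_comm _ (Φ.lam k ^ (2 * (s - 1)))]
    refine mul_le_mul_of_nonneg_left (le_trans ?_ (hE k t ht)) (hl k)
    linarith [sq_nonneg ‖ut k t‖]
  · rw [mul_left_comm _ (Φ.lam k ^ (2 * (s - 1)))]
    refine mul_le_mul_of_nonneg_left (le_trans ?_ (hE k t ht)) (hl k)
    have : 0 ≤ Φ.lam k ^ 2 * ‖u k t‖ ^ 2 := by positivity
    linarith
  · have key : ∀ k, w t k - u k t = 0 ∧ wt t k - ut k t = 0 := fun k => by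
      refine ode_solution_eq_zero (u := fun t => w t k - u k t) (ut := fun t => wt t k - ut k t)
        hT (hQo k) (fun τ hτ => (hw.deriv k τ hτ).sub (hu k τ hτ)) (fun τ hτ => ?_) ?_ ?_ ht
      · refine ((hw.equation k τ hτ).sub (hut k τ hτ)).congr_deriv ?_
        simp only [fn]
        push_cast
        ring
      · simp [hw.init, hu0]
      · simp [hw.init_t, hut0]
    exact ⟨funext fun k => sub_eq_zero.1 (key k).1, funext fun k => sub_eq_zero.1 (key k).2⟩

end Eigenbasis

end

/-! ### Abstract spectral theory of compact operators. -/

section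

section Spectral

variable {H : Type*} [NormedAddCommGroup H] [InnerProductSpace ℂ H]

/-- Orthonormal vectors lie `√2` apart, so balls of radius `1 / 2` around them are disjoint. -/
theorem countable_of_orthonormal [TopologicalSpace.SeparableSpace H] {ι : Type*} {v : ι → H}
    (hv : Orthonormal ℂ v) : Countable ι := by
  refine Pairwise.countable_of_isOpen_disjoint (s := fun i => Metric.ball (v i) (1 / 2))
    (fun i j hij => ?_) (fun i => Metric.isOpen_ball)
    (fun i => ⟨v i, Metric.mem_ball_self (by norm_num)⟩)
  refine Metric.ball_disjoint_ball ?_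
  have h : ‖v i - v j‖ ^ 2 = 2 := by
    rw [@norm_sub_sq ℂ, hv.1 i, hv.1 j, hv.2 hij]
    norm_num
  rw [dist_eq_norm]
  nlinarith [norm_nonneg (v i - v j)]

/-- The spectral theorem for compact symmetric operators, in terms of an orthonormal basis. -/
theorem exists_hilbertBasis_of_isCompactOperator [CompleteSpace H]
    [TopologicalSpace.SeparableSpace H]
    (hinf : ¬ FiniteDimensional ℂ H) {K : H →L[ℂ] H} (hK : IsCompactOperator K)
    (hs : K.IsSymmetric) :
    ∃ φ : HilbertBasis ℕ ℂ H, ∀ k, ∃ μ : ℂ, K (φ k) = μ • φ k := by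
  let G : ℂ → Submodule ℂ H := fun μ => Module.End.eigenspace (K : Module.End ℂ H) μ
  have hGc : ∀ μ, CompleteSpace (G μ) := fun μ => by
    have : IsClosed (G μ : Set H) := by
      have : (G μ : Set H) = {x | K x = μ • x} := by
        ext x
        simp [G]
      rw [this]
      exact isClosed_eq K.continuous (continuous_const_smul μ)
    exact this.completeSpace_coe
  -- Hilbert bases of all eigenspaces, the kernel included, are joined into one family; compactness
  -- makes the eigenspaces span a dense subspace.
  choose w b hb using fun μ => exists_hilbertBasis ℂ (G μ)
  have hfam : OrthogonalFamily ℂ (fun μ => G μ) fun μ => (G μ).subtypeₗᵢ :=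
    hs.orthogonalFamily_eigenspaces
  have hv := hfam.orthonormal_sigma_orthonormal (v_family := fun μ i => b μ i)
    fun μ => (b μ).orthonormal
  set v : (Σ μ, w μ) → H := fun a => (G a.1).subtypeₗᵢ (b a.1 a.2) with hvdef
  have hspan : (Submodule.span ℂ (Set.range v))ᗮ = ⊥ := by
    rw [eq_bot_iff, ← ContinuousLinearMap.orthogonalComplement_iSup_eigenspaces_eq_bot hK hs]
    intro x hx
    rw [← Submodule.iInf_orthogonal, Submodule.mem_iInf]
    intro μ y hy
    have hz : (innerSL ℂ x).comp (G μ).subtypeL = 0 := by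
      refine ContinuousLinearMap.ext_on
        (Submodule.dense_iff_topologicalClosure_eq_top.2 (b μ).dense_span) ?_
      rintro _ ⟨i, rfl⟩
      have := hx _ (Submodule.subset_span ⟨⟨μ, i⟩, rfl⟩)
      exact inner_eq_zero_symm.1 this
    exact inner_eq_zero_symm.1 (DFunLike.congr_fun hz ⟨y, hy⟩)
  have hcount : Countable (Σ μ, w μ) := countable_of_orthonormal hv
  -- A finite index set would make `H` finite-dimensional; being countably infinite, the family can
  -- be indexed by `ℕ`.
  have hinfi : Infinite (Σ μ, w μ) := by
    rw [← not_finite_iff_infinite]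
    intro hfin
    have := Fintype.ofFinite (Σ μ, w μ)
    exact hinf ((HilbertBasis.mkOfOrthogonalEqBot hv hspan).toOrthonormalBasis.toBasis
      |>.finiteDimensional_of_finite)
  obtain ⟨e⟩ : Nonempty (ℕ ≃ Σ μ, w μ) := nonempty_equiv_of_countable
  have hspan' : (Submodule.span ℂ (Set.range (v ∘ e)))ᗮ = ⊥ := by
    rwa [e.surjective.range_comp]
  refine ⟨HilbertBasis.mkOfOrthogonalEqBot (hv.comp e e.injective) hspan', fun k => ⟨(e k).1, ?_⟩⟩
  rw [HilbertBasis.coe_mkOfOrthogonalEqBot]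
  exact Module.End.mem_eigenspace_iff.1 (b (e k).1 (e k).2).2

/-- An operator between Hilbert spaces that is small on subspaces of finite codimension is
compact. -/
theorem isCompactOperator_of_forall_exists_finiteDimensional {H' : Type*} [NormedAddCommGroup H']
    [InnerProductSpace ℂ H'] [CompleteSpace H'] {J : H →L[ℂ] H'}
    (hJ : ∀ ε > 0, ∃ V : Submodule ℂ H, FiniteDimensional ℂ V ∧ ∀ x ∈ Vᗮ, ‖J x‖ ≤ ε * ‖x‖) :
    IsCompactOperator J := by
  refine (isClosed_setOfPred_isCompactOperator (σ₁₂ := RingHom.id ℂ)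
    (M₁ := H) (M₂ := H')).closure_subset (Metric.mem_closure_iff.2 fun ε hε => ?_)
  obtain ⟨V, hV, hVJ⟩ := hJ (ε / 2) (half_pos hε)
  -- This operator has finite rank and is within `ε / 2` of `J`; compact operators form a
  -- norm-closed set.
  refine ⟨J.comp V.starProjection, ?_, ?_⟩
  · have := FiniteDimensional.proper ℂ V
    have h1 : IsCompactOperator V.orthogonalProjectionOnto :=
      isCompactOperator_of_locallyCompactSpace_dom V.orthogonalProjectionOnto
    exact h1.clm_comp (J.comp V.subtypeL)
  · rw [dist_eq_norm]
    refine lt_of_le_of_lt (ContinuousLinearMap.opNorm_le_bound _ (half_pos hε).le fun x => ?_)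
      (half_lt_self hε)
    have h1 : (J - J.comp V.starProjection) x = J (x - V.starProjection x) := by simp
    rw [h1]
    refine (hVJ _ (Submodule.sub_starProjection_mem_orthogonal x)).trans ?_
    gcongr
    rw [← Submodule.starProjection_orthogonal_val]
    exact Submodule.norm_starProjection_apply_le _ _

end Spectral

end

/-! ### Test functions and the magnetic Poincaré inequality. -/

section

variable {N : ℕ} {Ω : Set (EuclideanSpace ℝ (Fin N))}
  {A : EuclideanSpace ℝ (Fin N) → EuclideanSpace ℝ (Fin N)}

namespace IsTestFunction

variable {ψ χ : EuclideanSpace ℝ (Fin N) → ℂ}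

theorem zero : IsTestFunction Ω (fun _ => 0) :=
  ⟨contDiff_const, HasCompactSupport.zero, by simp [tsupport, Function.support]⟩

theorem add (hψ : IsTestFunction Ω ψ) (hχ : IsTestFunction Ω χ) :
    IsTestFunction Ω (fun x => ψ x + χ x) :=
  ⟨hψ.1.add hχ.1, hψ.2.1.add hχ.2.1,
    (tsupport_add ψ χ).trans (union_subset hψ.2.2 hχ.2.2)⟩

theorem const_mul (c : ℂ) (hψ : IsTestFunction Ω ψ) : IsTestFunction Ω (fun x => c * ψ x) :=
  ⟨contDiff_const.mul hψ.1, hψ.2.1.mul_left,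
    (closure_mono (Function.support_mul_subset_right _ _)).trans hψ.2.2⟩

theorem differentiable (hψ : IsTestFunction Ω ψ) : Differentiable ℝ ψ :=
  hψ.1.differentiable (by simp)

theorem partialDeriv (hψ : IsTestFunction Ω ψ) (j : Fin N) :
    IsTestFunction Ω (partialDeriv j ψ) :=
  ⟨(hψ.1.fderiv_right (m := ∞) (by simp)).clm_apply contDiff_const, hψ.2.1.fderiv_apply ℝ _,
    (tsupport_fderiv_apply_subset ℝ _).trans hψ.2.2⟩

theorem memLp (hψ : IsTestFunction Ω ψ) : MemLp ψ 2 (volume.restrict Ω) :=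
  hψ.1.continuous.memLp_of_hasCompactSupport hψ.2.1

theorem eq_zero (hψ : IsTestFunction Ω ψ) {x : EuclideanSpace ℝ (Fin N)} (hx : x ∉ Ω) :
    ψ x = 0 :=
  image_eq_zero_of_notMem_tsupport fun h => hx (hψ.2.2 h)

theorem partialDeriv_mul_integral (hψ : IsTestFunction Ω ψ) (hχ : IsTestFunction Ω χ)
    (j : Fin N) :
    ∫ x in Ω, MagneticWave.partialDeriv j ψ x * χ x =
      -∫ x in Ω, ψ x * MagneticWave.partialDeriv j χ x := by
  have h1 := (hψ.partialDeriv j).1.continuous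
  have h2 := (hχ.partialDeriv j).1.continuous
  have key := integral_mul_fderiv_eq_neg_fderiv_mul_of_integrable (μ := volume)
    (f := ψ) (g := χ) (v := EuclideanSpace.single j (1 : ℝ))
    ((h1.mul hχ.1.continuous).integrable_of_hasCompactSupport hχ.2.1.mul_left)
    ((hψ.1.continuous.mul h2).integrable_of_hasCompactSupport hψ.2.1.mul_right)
    ((hψ.1.continuous.mul hχ.1.continuous).integrable_of_hasCompactSupport hψ.2.1.mul_right)
    (fun x _ => hψ.differentiable x) (fun x _ => hχ.differentiable x)
  rw [setIntegral_eq_integral_of_forall_compl_eq_zero fun x hx => by rw [hχ.eq_zero hx, mul_zero],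
    setIntegral_eq_integral_of_forall_compl_eq_zero fun x hx => by rw [hψ.eq_zero hx, zero_mul]]
  exact (neg_eq_iff_eq_neg.2 key).symm

section Potential

variable {a : ℝ} (hΩ : IsOpen Ω) (hA : ContinuousOn A Ω) (ha : ∀ x ∈ Ω, ‖A x‖ ≤ a)
include hΩ hA ha

theorem potential_mul_memLp (hψ : IsTestFunction Ω ψ) (j : Fin N) :
    MemLp (fun x => ((A x j : ℝ) : ℂ) * ψ x) 2 (volume.restrict Ω) := by
  have hc : ContinuousOn (fun x => ((A x j : ℝ) : ℂ) * ψ x) Ω := by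
    have : ContinuousOn (fun x => A x j) Ω :=
      (EuclideanSpace.proj (𝕜 := ℝ) j).continuous.comp_continuousOn hA
    exact (Complex.continuous_ofReal.comp_continuousOn this).mul hψ.1.continuous.continuousOn
  refine hψ.memLp.of_le_mul (c := a) (hc.aestronglyMeasurable hΩ.measurableSet) ?_
  filter_upwards [ae_restrict_mem hΩ.measurableSet] with x hx
  rw [norm_mul, Complex.norm_real]
  have := (PiLp.norm_apply_le (A x) j).trans (ha x hx)
  gcongr

theorem magneticPartial_memLp (hψ : IsTestFunction Ω ψ) (j : Fin N) :
    MemLp (magneticPartial A j ψ) 2 (volume.restrict Ω) :=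
  ((hψ.partialDeriv j).memLp.const_mul Complex.I).add (hψ.potential_mul_memLp hΩ hA ha j)

theorem magneticPartial_mul_integral (hψ : IsTestFunction Ω ψ) (hχ : IsTestFunction Ω χ)
    (j : Fin N) :
    ∫ x in Ω, magneticPartial A j ψ x * χ x =
      ∫ x in Ω, ψ x * (-Complex.I * MagneticWave.partialDeriv j χ x +
        ((A x j : ℝ) : ℂ) * χ x) := by
  have h1 := ((hψ.partialDeriv j).memLp.const_mul Complex.I).integrable_mul hχ.memLp
  have h2 := (hψ.potential_mul_memLp hΩ hA ha j).integrable_mul hχ.memLp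
  have h3 := (hψ.memLp.const_mul (-Complex.I)).integrable_mul (hχ.partialDeriv j).memLp
  have e1 : (∫ x in Ω, magneticPartial A j ψ x * χ x) =
      Complex.I * (∫ x in Ω, MagneticWave.partialDeriv j ψ x * χ x) +
        ∫ x in Ω, ((A x j : ℝ) : ℂ) * ψ x * χ x := by
    rw [← integral_const_mul, ← integral_add (by simpa [mul_assoc, Pi.mul_def] using h1)
      (by simpa [Pi.mul_def] using h2)]
    refine integral_congr_ae (ae_of_all _ fun x => ?_)
    simp only [magneticPartial]
    ring
  have e2 : (∫ x in Ω, ψ x * (-Complex.I * MagneticWave.partialDeriv j χ x +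
        ((A x j : ℝ) : ℂ) * χ x)) =
      -Complex.I * (∫ x in Ω, ψ x * MagneticWave.partialDeriv j χ x) +
        ∫ x in Ω, ((A x j : ℝ) : ℂ) * ψ x * χ x := by
    rw [← integral_const_mul, ← integral_add (by simpa [mul_assoc, Pi.mul_def] using h3)
      (by simpa [Pi.mul_def] using h2)]
    refine integral_congr_ae (ae_of_all _ fun x => ?_)
    ring
  rw [e1, e2, hψ.partialDeriv_mul_integral hχ j]
  ring

/-- Poincaré's inequality for the magnetic gradient: only `|ψ|²` is differentiated, so that the
potential does not enter. -/
theorem integral_norm_sq_le (hψ : IsTestFunction Ω ψ) {R : ℝ} (hR : ∀ x ∈ Ω, ‖x‖ ≤ R)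
    (j : Fin N) :
    ∫ x in Ω, ‖ψ x‖ ^ 2 ≤ 4 * R ^ 2 * ∫ x in Ω, ‖magneticPartial A j ψ x‖ ^ 2 := by
  have hf : ContDiff ℝ ∞ fun x => ‖ψ x‖ ^ 2 := hψ.1.norm_sq ℝ
  have hfs : HasCompactSupport fun x => ‖ψ x‖ ^ 2 :=
    hψ.2.1.comp_left (g := fun z : ℂ => ‖z‖ ^ 2) (by simp)
  set v : EuclideanSpace ℝ (Fin N) := EuclideanSpace.single j 1 with hv
  have hf' : ∀ x, fderiv ℝ (fun x => ‖ψ x‖ ^ 2) x v =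
      2 * inner ℝ (ψ x) (MagneticWave.partialDeriv j ψ x) := fun x => by
    rw [(hψ.differentiable x).hasFDerivAt.norm_sq.fderiv]
    simp [MagneticWave.partialDeriv, hv]
    ring
  have hg' : ∀ x, fderiv ℝ (fun x : EuclideanSpace ℝ (Fin N) => x j) x v = 1 := fun x => by
    have : (fun x : EuclideanSpace ℝ (Fin N) => x j) = EuclideanSpace.proj (𝕜 := ℝ) j := rfl
    rw [this, ContinuousLinearMap.fderiv]
    simp [hv]
  have hfc : Continuous fun x => fderiv ℝ (fun x => ‖ψ x‖ ^ 2) x v :=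
    (hf.continuous_fderiv (by simp)).clm_apply continuous_const
  have hxj : Continuous fun x : EuclideanSpace ℝ (Fin N) => x j :=
    (EuclideanSpace.proj (𝕜 := ℝ) j).continuous
  have i1 : Integrable fun x => fderiv ℝ (fun x => ‖ψ x‖ ^ 2) x v * x j :=
    (hfc.mul hxj).integrable_of_hasCompactSupport (hfs.fderiv_apply ℝ v).mul_right
  have i2 : Integrable fun x => ‖ψ x‖ ^ 2 := hf.continuous.integrable_of_hasCompactSupport hfs
  -- Integration by parts against the coordinate `x j`, which has derivative `1` along `v` and is
  -- bounded by `R` on `Ω`.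
  have key := integral_mul_fderiv_eq_neg_fderiv_mul_of_integrable (μ := volume) (v := v)
    (f := fun x => ‖ψ x‖ ^ 2) (g := fun x : EuclideanSpace ℝ (Fin N) => x j) i1
    (by simpa only [hg', mul_one] using i2)
    ((hf.continuous.mul hxj).integrable_of_hasCompactSupport hfs.mul_right)
    (fun x _ => hf.differentiable (by simp) x)
    (fun x _ => (EuclideanSpace.proj (𝕜 := ℝ) j).differentiableAt)
  simp only [hg', mul_one] at key
  rw [← setIntegral_eq_integral_of_forall_compl_eq_zero (s := Ω) (f := fun x => ‖ψ x‖ ^ 2)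
      fun x hx => by simp [hψ.eq_zero hx],
    ← setIntegral_eq_integral_of_forall_compl_eq_zero (s := Ω)
      (f := fun x => fderiv ℝ (fun x => ‖ψ x‖ ^ 2) x v * x j)
      fun x hx => by rw [hf', hψ.eq_zero hx]; simp, ← integral_neg] at key
  have hm : Integrable (fun x => ‖magneticPartial A j ψ x‖ ^ 2) (volume.restrict Ω) :=
    (hψ.magneticPartial_memLp hΩ hA ha j).integrable_norm_pow (p := 2) two_ne_zero
  -- Young's inequality; the term with `1 / 2` is absorbed into the left side at the end.
  have hle : ∫ x in Ω, -(fderiv ℝ (fun x => ‖ψ x‖ ^ 2) x v * x j) ≤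
      ∫ x in Ω, (1 / 2 * ‖ψ x‖ ^ 2 + 2 * R ^ 2 * ‖magneticPartial A j ψ x‖ ^ 2) := by
    refine setIntegral_mono_on i1.neg.integrableOn
      ((i2.restrict.const_mul _).add (hm.const_mul _)) hΩ.measurableSet fun x hx => ?_
    rw [hf']
    have h1 : |inner ℝ (ψ x) (MagneticWave.partialDeriv j ψ x)| ≤
        ‖ψ x‖ * ‖magneticPartial A j ψ x‖ := by
      -- The second arguments differ by a real multiple of `iψ`, orthogonal to `ψ` for the real
      -- inner product.
      have h2 : inner ℝ (ψ x) (MagneticWave.partialDeriv j ψ x) =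
          inner ℝ (ψ x) (-Complex.I * magneticPartial A j ψ x) := by
        simp only [magneticPartial, Complex.inner, Complex.mul_re, Complex.mul_im, Complex.neg_re,
          Complex.neg_im, Complex.add_re, Complex.add_im, Complex.I_re, Complex.I_im,
          Complex.ofReal_re, Complex.ofReal_im, Complex.conj_re, Complex.conj_im]
        ring
      rw [h2]
      refine (abs_real_inner_le_norm _ _).trans (le_of_eq ?_)
      simp
    have h3 : |x j| ≤ R := (PiLp.norm_apply_le x j).trans (hR x hx)
    have h4 : |2 * inner ℝ (ψ x) (MagneticWave.partialDeriv j ψ x) * x j| ≤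
        2 * (‖ψ x‖ * ‖magneticPartial A j ψ x‖) * R := by
      rw [abs_mul, abs_mul, abs_two]
      gcongr
    have h5 := neg_le_of_abs_le h4
    nlinarith [sq_nonneg (‖ψ x‖ - 2 * R * ‖magneticPartial A j ψ x‖)]
  rw [← key, integral_add (i2.restrict.const_mul _) (hm.const_mul _), integral_const_mul,
    integral_const_mul] at hle
  linarith

end Potential

end IsTestFunction

end

/-! ### Rellich's theorem through the Fourier transform. -/

section

variable {N : ℕ} {Ω : Set (EuclideanSpace ℝ (Fin N))}

/-- The norm of a Schwartz function is controlled by its low frequencies and its gradient. -/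
theorem integral_norm_sq_le_lowFrequency (f : SchwartzMap (EuclideanSpace ℝ (Fin N)) ℂ) {M : ℝ}
    (hM : 0 < M) :
    ∫ x, ‖f x‖ ^ 2 ≤ (∫ ξ in Metric.closedBall 0 M, ‖𝓕 f ξ‖ ^ 2) +
      1 / M ^ 2 * ∑ j, ∫ x, ‖partialDeriv j f x‖ ^ 2 := by
  have hint : ∀ g : SchwartzMap (EuclideanSpace ℝ (Fin N)) ℂ, Integrable fun x => ‖g x‖ ^ 2 :=
    fun g => (g.memLp 2).integrable_norm_pow (p := 2) two_ne_zero
  set D : Fin N → SchwartzMap (EuclideanSpace ℝ (Fin N)) ℂ := fun j =>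
    LineDeriv.lineDerivOp (EuclideanSpace.single j (1 : ℝ)) f with hD
  have hDp : ∀ j x, D j x = partialDeriv j f x := fun j x =>
    SchwartzMap.lineDerivOp_apply_eq_fderiv _ _ _
  have hDF : ∀ j ξ, ‖𝓕 (D j) ξ‖ = 2 * Real.pi * |ξ j| * ‖𝓕 f ξ‖ := fun j ξ => by
    have ht : (fun x : EuclideanSpace ℝ (Fin N) =>
        inner ℝ x (EuclideanSpace.single j (1 : ℝ))).HasTemperateGrowth := by fun_prop
    simp only [hD]
    rw [SchwartzMap.fourier_lineDerivOp_eq, smul_apply,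
      SchwartzMap.smulLeftCLM_apply_apply ht, norm_smul, norm_smul,
      EuclideanSpace.inner_single_right]
    simp [abs_of_pos Real.pi_pos, mul_assoc]
  simp only [← hDp]
  have e : ∑ j, ∫ x, ‖D j x‖ ^ 2 = ∫ ξ, ∑ j, ‖𝓕 (D j) ξ‖ ^ 2 := by
    rw [integral_finsetSum _ fun j _ => hint _]
    exact Finset.sum_congr rfl fun j _ => ((D j).integral_norm_sq_fourier).symm
  rw [e, ← f.integral_norm_sq_fourier, ← integral_const_mul,
    ← integral_indicator Metric.isClosed_closedBall.measurableSet,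
    ← integral_add ((hint _).indicator Metric.isClosed_closedBall.measurableSet)
      ((integrable_finsetSum _ fun j _ => hint _).const_mul _)]
  refine integral_mono (hint _) (((hint _).indicator
    Metric.isClosed_closedBall.measurableSet).add
      ((integrable_finsetSum _ fun j _ => hint _).const_mul _)) fun ξ => ?_
  beta_reduce
  -- Inside the ball the low-frequency term suffices; outside, `‖ξ‖² / M² ≥ 1` and the gradient term
  -- does.
  by_cases hξ : ξ ∈ Metric.closedBall 0 M
  · rw [indicator_of_mem hξ]
    exact le_add_of_nonneg_right (by positivity)
  · rw [indicator_of_notMem hξ, zero_add]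
    have h1 : ∑ j, ‖𝓕 (D j) ξ‖ ^ 2 = (2 * Real.pi) ^ 2 * ‖ξ‖ ^ 2 * ‖𝓕 f ξ‖ ^ 2 := by
      simp_rw [hDF, mul_pow, sq_abs]
      rw [EuclideanSpace.norm_sq_eq, ← Finset.sum_mul, ← Finset.mul_sum]
      simp
    have h2 : M < ‖ξ‖ := by simpa using hξ
    have h3 : 1 ≤ (2 * Real.pi) ^ 2 := by nlinarith [Real.pi_gt_three]
    rw [h1, div_mul_eq_mul_div, one_mul, le_div_iff₀ (by positivity)]
    calc ‖𝓕 f ξ‖ ^ 2 * M ^ 2 ≤ ‖𝓕 f ξ‖ ^ 2 * ‖ξ‖ ^ 2 := by gcongr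
      _ ≤ (2 * Real.pi) ^ 2 * (‖𝓕 f ξ‖ ^ 2 * ‖ξ‖ ^ 2) := le_mul_of_one_le_left (by positivity) h3
      _ = _ := by ring

/-- The exponential `x ↦ exp(2πi x·ξ)`. -/
noncomputable def planeWave (ξ x : EuclideanSpace ℝ (Fin N)) : ℂ :=
  Complex.exp (Complex.I * ((2 * Real.pi * inner ℝ x ξ : ℝ) : ℂ))

theorem continuous_planeWave (ξ : EuclideanSpace ℝ (Fin N)) : Continuous (planeWave ξ) := by
  unfold planeWave
  fun_prop

theorem norm_planeWave (ξ x : EuclideanSpace ℝ (Fin N)) : ‖planeWave ξ x‖ = 1 := by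
  rw [planeWave, mul_comm]
  exact Complex.norm_exp_ofReal_mul_I _

theorem norm_planeWave_sub_le (ξ η x : EuclideanSpace ℝ (Fin N)) :
    ‖planeWave ξ x - planeWave η x‖ ≤ 2 * Real.pi * ‖x‖ * ‖ξ - η‖ := by
  have h1 : planeWave ξ x - planeWave η x = planeWave η x *
      (Complex.exp (Complex.I * ((2 * Real.pi * inner ℝ x (ξ - η) : ℝ) : ℂ)) - 1) := by
    rw [planeWave, planeWave, mul_sub, ← Complex.exp_add, mul_one, inner_sub_right]
    push_cast
    ring_nf
  rw [h1, norm_mul, norm_planeWave, one_mul]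
  refine Real.norm_exp_I_mul_ofReal_sub_one_le.trans ?_
  rw [Real.norm_eq_abs, abs_mul, abs_of_pos (by positivity : 0 < 2 * Real.pi), mul_assoc (2 * Real.pi)]
  gcongr
  exact abs_real_inner_le_norm _ _

theorem fourier_eq_integral_planeWave (f : EuclideanSpace ℝ (Fin N) → ℂ)
    (ξ : EuclideanSpace ℝ (Fin N)) :
    𝓕 f ξ = ∫ x, (starRingEnd ℂ) (planeWave ξ x) * f x := by
  rw [Real.fourier_eq']
  refine integral_congr_ae (ae_of_all _ fun x => ?_)
  simp only [planeWave, ← Complex.exp_conj, map_mul, Complex.conj_I, Complex.conj_ofReal,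
    smul_eq_mul]
  congr 2
  push_cast
  ring

theorem L2_norm_sq_eq_integral {μ : Measure (EuclideanSpace ℝ (Fin N))} (f : Lp ℂ 2 μ) :
    ‖f‖ ^ 2 = ∫ x, ‖f x‖ ^ 2 ∂μ := by
  have h : ((‖f‖ ^ 2 : ℝ) : ℂ) = ((∫ x, ‖f x‖ ^ 2 ∂μ : ℝ) : ℂ) := by
    rw [← integral_complex_ofReal]
    have := inner_self_eq_norm_sq_to_K (𝕜 := ℂ) f
    rw [L2.inner_def] at this
    simp only [inner_self_eq_norm_sq_to_K] at this
    simpa using this.symm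
  exact_mod_cast h

theorem L2_norm_sq_eq_of_ae {μ : Measure (EuclideanSpace ℝ (Fin N))} {f : Lp ℂ 2 μ}
    {g : EuclideanSpace ℝ (Fin N) → ℂ} (h : f =ᵐ[μ] g) : ‖f‖ ^ 2 = ∫ x, ‖g x‖ ^ 2 ∂μ := by
  rw [L2_norm_sq_eq_integral]
  exact integral_congr_ae (h.mono fun x hx => by simp only [hx])

section Waves

variable [hfin : IsFiniteMeasure (volume.restrict Ω)]

theorem planeWave_memLp (ξ : EuclideanSpace ℝ (Fin N)) :
    MemLp (planeWave ξ) 2 (volume.restrict Ω) :=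
  MemLp.of_bound (continuous_planeWave ξ).aestronglyMeasurable 1
    (ae_of_all _ fun x => (norm_planeWave ξ x).le)

/-- The exponential `x ↦ exp(2πi x·ξ)` in `L²(Ω)`. -/
noncomputable def waveL2 (Ω : Set (EuclideanSpace ℝ (Fin N)))
    [IsFiniteMeasure (volume.restrict Ω)] (ξ : EuclideanSpace ℝ (Fin N)) : L2 Ω :=
  (planeWave_memLp ξ).toLp

/-- This Lipschitz bound allows a ball of frequencies to be replaced by a finite net. -/
theorem exists_norm_waveL2_sub_le (hΩ : IsOpen Ω) {R : ℝ} (hR : ∀ x ∈ Ω, ‖x‖ ≤ R) :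
    ∃ C, 0 ≤ C ∧ ∀ ξ η : EuclideanSpace ℝ (Fin N), ‖waveL2 Ω ξ - waveL2 Ω η‖ ≤ C * ‖ξ - η‖ := by
  refine ⟨(measureUnivNNReal (volume.restrict Ω)) ^ (2 : ℝ≥0∞).toReal⁻¹ * (2 * Real.pi * |R|),
    by positivity, fun ξ η => ?_⟩
  rw [mul_assoc]
  refine Lp.norm_le_of_ae_bound (by positivity) ?_
  filter_upwards [Lp.coeFn_sub (waveL2 Ω ξ) (waveL2 Ω η), (planeWave_memLp (Ω := Ω) ξ).coeFn_toLp,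
    (planeWave_memLp (Ω := Ω) η).coeFn_toLp, ae_restrict_mem hΩ.measurableSet] with x h1 h2 h3 h4
  rw [h1, Pi.sub_apply, waveL2, waveL2, h2, h3]
  refine (norm_planeWave_sub_le ξ η x).trans ?_
  have := (hR x h4).trans (le_abs_self R)
  gcongr

theorem IsTestFunction.fourier_eq_inner {ψ : EuclideanSpace ℝ (Fin N) → ℂ}
    (hψ : IsTestFunction Ω ψ) {w : L2 Ω} (hw : w =ᵐ[volume.restrict Ω] ψ)
    (ξ : EuclideanSpace ℝ (Fin N)) : 𝓕 ψ ξ = inner ℂ (waveL2 Ω ξ) w := by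
  rw [fourier_eq_integral_planeWave, L2.inner_def,
    ← setIntegral_eq_integral_of_forall_compl_eq_zero (s := Ω)
      fun x hx => by rw [hψ.eq_zero hx, mul_zero]]
  refine integral_congr_ae ?_
  filter_upwards [hw, (planeWave_memLp (Ω := Ω) ξ).coeFn_toLp] with x h1 h2
  rw [h1, waveL2, h2, RCLike.inner_apply, mul_comm]

/-- A quantitative form of Rellich's theorem: up to finitely many functionals on `L²(Ω)`, the
`L²`-norm of a test function is small compared to its `H¹`-norm. -/
theorem exists_finset_norm_sq_le (hΩ : IsOpen Ω) {R : ℝ} (hR : ∀ x ∈ Ω, ‖x‖ ≤ R) {ε : ℝ}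
    (hε : 0 < ε) :
    ∃ (t : Finset (L2 Ω)) (C : ℝ), 0 ≤ C ∧ ∀ (ψ : EuclideanSpace ℝ (Fin N) → ℂ),
      IsTestFunction Ω ψ → ∀ w : L2 Ω, w =ᵐ[volume.restrict Ω] ψ →
        ‖w‖ ^ 2 ≤ C * ∑ e ∈ t, ‖inner ℂ e w‖ ^ 2 +
          ε * (‖w‖ ^ 2 + ∑ j, ∫ x in Ω, ‖partialDeriv j ψ x‖ ^ 2) := by
  classical
  obtain ⟨M, hM0, hM⟩ : ∃ M : ℝ, 0 < M ∧ 1 / M ^ 2 ≤ ε := by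
    refine ⟨1 / √ε, by positivity, ?_⟩
    rw [div_pow, Real.sq_sqrt hε.le]
    simp
  obtain ⟨C, hC0, hC⟩ := exists_norm_waveL2_sub_le hΩ hR
  set B : Set (EuclideanSpace ℝ (Fin N)) := Metric.closedBall 0 M with hB
  have hBfin : volume B ≠ ⊤ := measure_closedBall_lt_top.ne
  set V : ℝ := volume.real B with hV
  have hV0 : 0 ≤ V := measureReal_nonneg
  -- `δ` is the mesh of the net: moving `ξ` to a net point costs at most `ε ‖w‖²` after integration
  -- over `B`.
  obtain ⟨δ, hδ0, hδ⟩ : ∃ δ : ℝ, 0 < δ ∧ V * (2 * (C * δ) ^ 2) ≤ ε := by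
    refine ⟨√(ε / (2 * (V + 1) * (C + 1) ^ 2)), by positivity, ?_⟩
    rw [mul_pow, Real.sq_sqrt (by positivity)]
    have : V * (2 * (C ^ 2 * (ε / (2 * (V + 1) * (C + 1) ^ 2)))) =
        ε * ((V * C ^ 2) / ((V + 1) * (C + 1) ^ 2)) := by field_simp
    rw [this]
    refine mul_le_of_le_one_right hε.le ((div_le_one (by positivity)).2 ?_)
    gcongr <;> linarith
  obtain ⟨s, hs, hsB⟩ := Metric.totallyBounded_iff.1
    (isCompact_closedBall (0 : EuclideanSpace ℝ (Fin N)) M).totallyBounded δ hδ0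
  refine ⟨hs.toFinset.image (waveL2 Ω), V * 2, by positivity, fun ψ hψ w hw => ?_⟩
  set S := ∑ e ∈ hs.toFinset.image (waveL2 Ω), ‖inner ℂ e w‖ ^ 2 with hS
  have hpt : ∀ ξ ∈ B, ‖𝓕 ψ ξ‖ ^ 2 ≤ 2 * S + 2 * (C * δ) ^ 2 * ‖w‖ ^ 2 := fun ξ hξ => by
    obtain ⟨η, hη, hξη⟩ := mem_iUnion₂.1 (hsB hξ)
    rw [hψ.fourier_eq_inner hw]
    have h1 : inner ℂ (waveL2 Ω ξ) w =
        inner ℂ (waveL2 Ω η) w + inner ℂ (waveL2 Ω ξ - waveL2 Ω η) w := by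
      rw [← inner_add_left]; simp
    have h2 : ‖inner ℂ (waveL2 Ω ξ - waveL2 Ω η) w‖ ≤ C * δ * ‖w‖ := by
      refine (norm_inner_le_norm _ _).trans ?_
      gcongr
      refine (hC ξ η).trans ?_
      rw [Metric.mem_ball, dist_eq_norm] at hξη
      gcongr
    have h3 : ‖inner ℂ (waveL2 Ω η) w‖ ^ 2 ≤ S :=
      Finset.single_le_sum (f := fun e => ‖inner ℂ e w‖ ^ 2) (fun e _ => sq_nonneg _)
        (Finset.mem_image_of_mem _ (hs.mem_toFinset.2 hη))
    have h4 := norm_add_le (inner ℂ (waveL2 Ω η) w) (inner ℂ (waveL2 Ω ξ - waveL2 Ω η) w)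
    rw [← h1] at h4
    have h5 : ‖inner ℂ (waveL2 Ω ξ) w‖ ^ 2 ≤
        (‖inner ℂ (waveL2 Ω η) w‖ + C * δ * ‖w‖) ^ 2 := by
      gcongr
      exact h4.trans (by gcongr)
    nlinarith [sq_nonneg (‖inner ℂ (waveL2 Ω η) w‖ - C * δ * ‖w‖)]
  have hwψ : ‖w‖ ^ 2 = ∫ x, ‖ψ x‖ ^ 2 := by
    rw [L2_norm_sq_eq_of_ae hw]
    exact setIntegral_eq_integral_of_forall_compl_eq_zero fun x hx => by simp [hψ.eq_zero hx]
  have hd : ∀ j, ∫ x in Ω, ‖partialDeriv j ψ x‖ ^ 2 = ∫ x, ‖partialDeriv j ψ x‖ ^ 2 := fun j =>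
    setIntegral_eq_integral_of_forall_compl_eq_zero fun x hx => by
      simp [(hψ.partialDeriv j).eq_zero hx]
  simp only [hd]
  have key : ∫ x, ‖ψ x‖ ^ 2 ≤ (∫ ξ in B, ‖𝓕 ψ ξ‖ ^ 2) +
      1 / M ^ 2 * ∑ j, ∫ x, ‖partialDeriv j ψ x‖ ^ 2 :=
    integral_norm_sq_le_lowFrequency (hψ.2.1.toSchwartzMap hψ.1) hM0
  rw [← hwψ] at key
  have hlow : ∫ ξ in B, ‖𝓕 ψ ξ‖ ^ 2 ≤ V * (2 * S + 2 * (C * δ) ^ 2 * ‖w‖ ^ 2) := by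
    have hi : IntegrableOn (fun ξ => ‖𝓕 ψ ξ‖ ^ 2) B :=
      (((𝓕 (hψ.2.1.toSchwartzMap hψ.1)).memLp 2 volume).integrable_norm_pow (p := 2)
        two_ne_zero).integrableOn
    refine (setIntegral_mono_on hi (integrableOn_const hBfin)
      Metric.isClosed_closedBall.measurableSet hpt).trans (le_of_eq ?_)
    rw [setIntegral_const, smul_eq_mul]
  set Q := ∑ j, ∫ x, ‖partialDeriv j ψ x‖ ^ 2 with hQ
  have hQ0 : 0 ≤ Q := Finset.sum_nonneg fun j _ => integral_nonneg fun x => sq_nonneg _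
  have h6 : 1 / M ^ 2 * Q ≤ ε * Q := by gcongr
  have h7 : V * (2 * (C * δ) ^ 2) * ‖w‖ ^ 2 ≤ ε * ‖w‖ ^ 2 := by gcongr
  linarith

end Waves

end

/-! ### The space `𝓗¹₀(Ω)` as a closed graph, and its compact embedding. -/

section

variable {N : ℕ} {Ω : Set (EuclideanSpace ℝ (Fin N))}
  {A : EuclideanSpace ℝ (Fin N) → EuclideanSpace ℝ (Fin N)}

/-- The Hilbert space of pairs `(w, g)`, where `g` has `N` components. -/
abbrev PairSpace (Ω : Set (EuclideanSpace ℝ (Fin N))) : Type :=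
  PiLp 2 fun _ : Option (Fin N) => L2 Ω

/-- The pair `(w, g)` as an element of `PairSpace Ω`. -/
noncomputable def pair (w : L2 Ω) (g : Fin N → L2 Ω) : PairSpace Ω :=
  WithLp.toLp 2 fun o => o.elim w g

/-- The graph of `i∇ + A` on test functions. -/
noncomputable def testGraph (Ω : Set (EuclideanSpace ℝ (Fin N)))
    (A : EuclideanSpace ℝ (Fin N) → EuclideanSpace ℝ (Fin N)) : Submodule ℂ (PairSpace Ω) where
  carrier := {x | ∃ ψ, IsTestFunction Ω ψ ∧ x none =ᵐ[volume.restrict Ω] ψ ∧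
    ∀ j : Fin N, x (some j) =ᵐ[volume.restrict Ω] magneticPartial A j ψ}
  zero_mem' := ⟨fun _ => 0, .zero, Lp.coeFn_zero _ _ _, fun j => by
    refine (Lp.coeFn_zero _ _ _).trans (ae_of_all _ fun x => ?_)
    simp [magneticPartial, partialDeriv]⟩
  add_mem' := by
    rintro x y ⟨ψ, hψ, hx, hxj⟩ ⟨χ, hχ, hy, hyj⟩
    refine ⟨_, hψ.add hχ, ?_, fun j => ?_⟩
    · filter_upwards [Lp.coeFn_add (x none) (y none), hx, hy] with z h1 h2 h3
      rw [PiLp.add_apply, h1, Pi.add_apply, h2, h3]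
    · filter_upwards [Lp.coeFn_add (x (some j)) (y (some j)), hxj j, hyj j] with z h1 h2 h3
      rw [PiLp.add_apply, h1, Pi.add_apply, h2, h3]
      simp only [magneticPartial, partialDeriv]
      rw [fderiv_fun_add (hψ.differentiable z) (hχ.differentiable z), add_apply]
      ring
  smul_mem' := by
    rintro c x ⟨ψ, hψ, hx, hxj⟩
    refine ⟨_, hψ.const_mul c, ?_, fun j => ?_⟩
    · filter_upwards [Lp.coeFn_smul c (x none), hx] with z h1 h2
      rw [PiLp.smul_apply, h1, Pi.smul_apply, h2, smul_eq_mul]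
    · filter_upwards [Lp.coeFn_smul c (x (some j)), hxj j] with z h1 h2
      rw [PiLp.smul_apply, h1, Pi.smul_apply, h2, smul_eq_mul]
      simp only [magneticPartial, partialDeriv]
      rw [fderiv_const_mul (hψ.differentiable z), smul_apply, smul_eq_mul]
      ring

/-- The space `𝓗¹₀(Ω)`, realized as the closure of the graph of `i∇ + A` on test functions. -/
noncomputable def dirichletSpace (Ω : Set (EuclideanSpace ℝ (Fin N)))
    (A : EuclideanSpace ℝ (Fin N) → EuclideanSpace ℝ (Fin N)) : Submodule ℂ (PairSpace Ω) :=
  (testGraph Ω A).topologicalClosure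

theorem dirichletSpace_subset {s : Set (PairSpace Ω)} (hs : IsClosed s)
    (h : (testGraph Ω A : Set (PairSpace Ω)) ⊆ s) : (dirichletSpace Ω A : Set (PairSpace Ω)) ⊆ s :=
  closure_minimal h hs

theorem integral_mul_eq_inner {g : EuclideanSpace ℝ (Fin N) → ℂ}
    (hg : MemLp g 2 (volume.restrict Ω)) (f : L2 Ω) :
    ∫ x in Ω, f x * g x = inner ℂ hg.star.toLp f := by
  rw [L2.inner_def]
  refine integral_congr_ae ?_
  filter_upwards [hg.star.coeFn_toLp] with x hx
  rw [hx, RCLike.inner_apply]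
  simp

section

variable {a : ℝ} (hΩ : IsOpen Ω) (hA : ContinuousOn A Ω) (ha : ∀ x ∈ Ω, ‖A x‖ ≤ a)
include hΩ hA ha

/-- The element of the graph given by a test function. -/
theorem IsTestFunction.pair_mem_testGraph {ψ : EuclideanSpace ℝ (Fin N) → ℂ}
    (hψ : IsTestFunction Ω ψ) :
    pair hψ.memLp.toLp (fun j => (hψ.magneticPartial_memLp hΩ hA ha j).toLp) ∈ testGraph Ω A :=
  ⟨ψ, hψ, hψ.memLp.coeFn_toLp, fun j => (hψ.magneticPartial_memLp hΩ hA ha j).coeFn_toLp⟩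

/-- With the converse `isDirichlet_of_mem`, this carries Hilbert space arguments in the closed graph
over to `IsDirichlet`. -/
theorem IsDirichlet.pair_mem {w : L2 Ω} {g : Fin N → L2 Ω} (h : IsDirichlet Ω A w g) :
    pair w g ∈ dirichletSpace Ω A := by
  obtain ⟨-, ψ, hψ, hw, hg⟩ := h
  refine mem_closure_of_tendsto (b := atTop) (f := fun n => pair (hψ n).memLp.toLp
    (fun j => ((hψ n).magneticPartial_memLp hΩ hA ha j).toLp)) ?_
    (Eventually.of_forall fun n => (hψ n).pair_mem_testGraph hΩ hA ha)
  refine ((PiLp.continuous_toLp 2 _).tendsto _).comp (tendsto_pi_nhds.2 fun o => ?_)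
  cases o with
  | none =>
    rw [Lp.tendsto_Lp_iff_tendsto_eLpNorm']
    refine hw.congr fun n => eLpNorm_congr_ae ?_
    filter_upwards [(hψ n).memLp.coeFn_toLp] with x hx
    simp [hx]
  | some j =>
    rw [Lp.tendsto_Lp_iff_tendsto_eLpNorm']
    refine (hg j).congr fun n => eLpNorm_congr_ae ?_
    filter_upwards [((hψ n).magneticPartial_memLp hΩ hA ha j).coeFn_toLp] with x hx
    simp [hx]

theorem isDirichlet_of_mem {x : PairSpace Ω} (hx : x ∈ dirichletSpace Ω A) :
    IsDirichlet Ω A (x none) fun j => x (some j) := by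
  have hcont : ∀ o, Continuous fun x : PairSpace Ω => x o := fun o =>
    (PiLp.proj (𝕜 := ℂ) 2 (fun _ : Option (Fin N) => L2 Ω) o).continuous
  refine ⟨fun χ hχ j => ?_, ?_⟩
  · have hm : MemLp (fun x => -Complex.I * partialDeriv j χ x + ((A x j : ℝ) : ℂ) * χ x) 2
        (volume.restrict Ω) :=
      ((hχ.partialDeriv j).memLp.const_mul _).add (hχ.potential_mul_memLp hΩ hA ha j)
    -- Both sides are inner products with fixed `L²` functions, so the weak identity is a closed
    -- condition and is checked on test functions.
    refine dirichletSpace_subset (s := {x | ∫ y in Ω, x (some j) y * χ y =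
      ∫ y in Ω, x none y * (-Complex.I * partialDeriv j χ y + ((A y j : ℝ) : ℂ) * χ y)}) ?_ ?_ hx
    · simp only [integral_mul_eq_inner hχ.memLp, integral_mul_eq_inner hm]
      exact isClosed_eq (continuous_const.inner (hcont _)) (continuous_const.inner (hcont _))
    · rintro y ⟨ψ, hψ, h1, h2⟩
      have e1 : ∫ z in Ω, y (some j) z * χ z = ∫ z in Ω, magneticPartial A j ψ z * χ z :=
        integral_congr_ae ((h2 j).mono fun z hz => by simp only [hz])
      have e2 : ∫ z in Ω, y none z *
          (-Complex.I * partialDeriv j χ z + ((A z j : ℝ) : ℂ) * χ z) =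
          ∫ z in Ω, ψ z * (-Complex.I * partialDeriv j χ z + ((A z j : ℝ) : ℂ) * χ z) :=
        integral_congr_ae (h1.mono fun z hz => by simp only [hz])
      simp only [mem_ofPred_eq]
      rw [e1, e2]
      exact hψ.magneticPartial_mul_integral hΩ hA ha hχ j
  · obtain ⟨y, hy, hlim⟩ := mem_closure_iff_seq_limit.1 hx
    choose ψ hψ h1 h2 using hy
    refine ⟨ψ, hψ, ?_, fun j => ?_⟩
    · have := (Lp.tendsto_Lp_iff_tendsto_eLpNorm' _ _).1 (((hcont none).tendsto x).comp hlim)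
      refine this.congr fun n => eLpNorm_congr_ae ?_
      filter_upwards [h1 n] with z hz
      simp [hz]
    · have := (Lp.tendsto_Lp_iff_tendsto_eLpNorm' _ _).1 (((hcont (some j)).tendsto x).comp hlim)
      refine this.congr fun n => eLpNorm_congr_ae ?_
      filter_upwards [h2 n j] with z hz
      simp [hz]

theorem dirichletSpace_poincare {R : ℝ} (hR : ∀ x ∈ Ω, ‖x‖ ≤ R) (j : Fin N) {x : PairSpace Ω}
    (hx : x ∈ dirichletSpace Ω A) : ‖x none‖ ^ 2 ≤ 4 * R ^ 2 * ‖x (some j)‖ ^ 2 := by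
  refine dirichletSpace_subset
    (s := {x | ‖x none‖ ^ 2 ≤ 4 * R ^ 2 * ‖x (some j)‖ ^ 2}) ?_ ?_ hx
  · have hcont : ∀ o, Continuous fun x : PairSpace Ω => x o := fun o =>
      (PiLp.proj (𝕜 := ℂ) 2 (fun _ : Option (Fin N) => L2 Ω) o).continuous
    exact isClosed_le ((hcont _).norm.pow 2) (continuous_const.mul ((hcont _).norm.pow 2))
  · rintro y ⟨ψ, hψ, h1, h2⟩
    simp only [mem_ofPred_eq]
    rw [L2_norm_sq_eq_of_ae h1, L2_norm_sq_eq_of_ae (h2 j)]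
    exact hψ.integral_norm_sq_le hΩ hA ha hR j

/-- Boundedness of `A` lets the magnetic graph norm control the ordinary gradient, to which
Rellich's estimate applies. -/
theorem norm_sq_partialDeriv_le {ψ : EuclideanSpace ℝ (Fin N) → ℂ} (hψ : IsTestFunction Ω ψ)
    (j : Fin N) : ∫ x in Ω, ‖partialDeriv j ψ x‖ ^ 2 ≤
      2 * (∫ x in Ω, ‖magneticPartial A j ψ x‖ ^ 2) + 2 * a ^ 2 * ∫ x in Ω, ‖ψ x‖ ^ 2 := by
  have i1 : Integrable (fun x => ‖magneticPartial A j ψ x‖ ^ 2) (volume.restrict Ω) :=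
    (hψ.magneticPartial_memLp hΩ hA ha j).integrable_norm_pow (p := 2) two_ne_zero
  have i2 : Integrable (fun x => ‖ψ x‖ ^ 2) (volume.restrict Ω) :=
    hψ.memLp.integrable_norm_pow (p := 2) two_ne_zero
  have i3 : Integrable (fun x => ‖partialDeriv j ψ x‖ ^ 2) (volume.restrict Ω) :=
    (hψ.partialDeriv j).memLp.integrable_norm_pow (p := 2) two_ne_zero
  rw [← integral_const_mul, ← integral_const_mul,
    ← integral_add (i1.const_mul _) (i2.const_mul _)]
  refine setIntegral_mono_on i3 ((i1.const_mul _).add (i2.const_mul _)) hΩ.measurableSet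
    fun x hx => ?_
  have h1 : ‖partialDeriv j ψ x‖ ≤ ‖magneticPartial A j ψ x‖ + a * ‖ψ x‖ := by
    have e : Complex.I * partialDeriv j ψ x =
        magneticPartial A j ψ x - ((A x j : ℝ) : ℂ) * ψ x := by
      simp only [magneticPartial]; ring
    have e2 : ‖partialDeriv j ψ x‖ = ‖Complex.I * partialDeriv j ψ x‖ := by simp
    rw [e2, e]
    refine (norm_sub_le _ _).trans ?_
    rw [norm_mul, Complex.norm_real]
    have := (PiLp.norm_apply_le (A x) j).trans (ha x hx)
    gcongr
  have h2 : ‖partialDeriv j ψ x‖ ^ 2 ≤ (‖magneticPartial A j ψ x‖ + a * ‖ψ x‖) ^ 2 := by gcongr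
  nlinarith [sq_nonneg (‖magneticPartial A j ψ x‖ - a * ‖ψ x‖)]

theorem exists_finset_norm_sq_le_of_mem [IsFiniteMeasure (volume.restrict Ω)] {R : ℝ}
    (hR : ∀ x ∈ Ω, ‖x‖ ≤ R) {ε : ℝ} (hε : 0 < ε) :
    ∃ (t : Finset (L2 Ω)) (C : ℝ), ∀ x ∈ dirichletSpace Ω A,
      ‖x none‖ ^ 2 ≤ C * ∑ e ∈ t, ‖inner ℂ e (x none)‖ ^ 2 + ε * ‖x‖ ^ 2 := by
  set B : ℝ := 3 + 2 * a ^ 2 * N with hB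
  have hB0 : 0 < B := by positivity
  obtain ⟨t, C, -, h⟩ := exists_finset_norm_sq_le hΩ hR (div_pos hε hB0)
  refine ⟨t, C, dirichletSpace_subset ?_ ?_⟩
  · have hcont : Continuous fun x : PairSpace Ω => x none :=
      (PiLp.proj (𝕜 := ℂ) 2 (fun _ : Option (Fin N) => L2 Ω) none).continuous
    refine isClosed_le (hcont.norm.pow 2) ((continuous_const.mul ?_).add
      (continuous_const.mul (continuous_norm.pow 2)))
    exact continuous_finsetSum _ fun e _ => (continuous_const.inner hcont).norm.pow 2
  · rintro x ⟨ψ, hψ, h1, h2⟩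
    refine (h ψ hψ _ h1).trans (add_le_add le_rfl ?_)
    have hx : ‖x‖ ^ 2 = ‖x none‖ ^ 2 + ∑ j, ‖x (some j)‖ ^ 2 := by
      rw [PiLp.norm_sq_eq_of_L2, Fintype.sum_option]
    have h3 : ∑ j, ∫ y in Ω, ‖partialDeriv j ψ y‖ ^ 2 ≤
        2 * ∑ j, ‖x (some j)‖ ^ 2 + 2 * a ^ 2 * N * ‖x none‖ ^ 2 := by
      calc _ ≤ ∑ j, (2 * ‖x (some j)‖ ^ 2 + 2 * a ^ 2 * ‖x none‖ ^ 2) := by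
            refine Finset.sum_le_sum fun j _ => ?_
            rw [L2_norm_sq_eq_of_ae h1, L2_norm_sq_eq_of_ae (h2 j)]
            exact norm_sq_partialDeriv_le hΩ hA ha hψ j
        _ = _ := by
            rw [Finset.sum_add_distrib, ← Finset.mul_sum, Finset.sum_const, Finset.card_univ,
              Fintype.card_fin, nsmul_eq_mul]
            ring
    have h4 : 0 ≤ ∑ j, ‖x (some j)‖ ^ 2 := Finset.sum_nonneg fun j _ => sq_nonneg _
    have h5 : ‖x none‖ ^ 2 + ∑ j, ∫ y in Ω, ‖partialDeriv j ψ y‖ ^ 2 ≤ B * ‖x‖ ^ 2 := by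
      rw [hx, hB]
      have : 0 ≤ 2 * a ^ 2 * N * ∑ j, ‖x (some j)‖ ^ 2 := by positivity
      nlinarith [sq_nonneg ‖x none‖]
    calc _ ≤ ε / B * (B * ‖x‖ ^ 2) := by gcongr
      _ = _ := by field_simp

end

/-- The embedding of `𝓗¹₀(Ω)` into `L²(Ω)`. -/
noncomputable def dirichletEmbedding (Ω : Set (EuclideanSpace ℝ (Fin N)))
    (A : EuclideanSpace ℝ (Fin N) → EuclideanSpace ℝ (Fin N)) : dirichletSpace Ω A →L[ℂ] L2 Ω :=
  (PiLp.proj 2 (fun _ : Option (Fin N) => L2 Ω) none).comp (dirichletSpace Ω A).subtypeL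

instance : CompleteSpace (dirichletSpace Ω A) :=
  (testGraph Ω A).isClosed_topologicalClosure.completeSpace_coe

theorem isCompactOperator_dirichletEmbedding {a : ℝ} (hΩ : IsOpen Ω) (hA : ContinuousOn A Ω)
    (ha : ∀ x ∈ Ω, ‖A x‖ ≤ a) [IsFiniteMeasure (volume.restrict Ω)] {R : ℝ}
    (hR : ∀ x ∈ Ω, ‖x‖ ≤ R) : IsCompactOperator (dirichletEmbedding Ω A) := by
  refine isCompactOperator_of_forall_exists_finiteDimensional fun ε hε => ?_
  obtain ⟨t, C, h⟩ := exists_finset_norm_sq_le_of_mem hΩ hA ha hR (pow_pos hε 2)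
  -- Orthogonality to `J* e` means `(e, J x) = 0`, so the finitely many functionals vanish on the
  -- complement of this span.
  refine ⟨Submodule.span ℂ ((dirichletEmbedding Ω A).adjoint '' t),
    FiniteDimensional.span_of_finite ℂ (t.finite_toSet.image _), fun x hx => ?_⟩
  have h1 : ∀ e ∈ t, inner ℂ e ((x : PairSpace Ω) none) = 0 := fun e he => by
    have := hx _ (Submodule.subset_span ⟨e, he, rfl⟩)
    rwa [ContinuousLinearMap.adjoint_inner_left] at this
  have h2 := h x x.2
  rw [Finset.sum_eq_zero fun e he => by rw [h1 e he]; simp, mul_zero, zero_add, ← mul_pow] at h2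
  exact (pow_le_pow_iff_left₀ (norm_nonneg _) (by positivity) two_ne_zero).1 h2

theorem eq_zero_of_forall_inner_testFunction [IsFiniteMeasure (volume.restrict Ω)]
    (hΩ : IsOpen Ω) {f : L2 Ω}
    (h : ∀ ψ (hψ : IsTestFunction Ω ψ), inner ℂ hψ.memLp.toLp f = 0) : f = 0 := by
  rw [Lp.eq_zero_iff_ae_eq_zero]
  have hf : IntegrableOn f Ω := (Lp.memLp f).integrable (by norm_num)
  refine (ae_restrict_iff' hΩ.measurableSet).2
    (hΩ.ae_eq_zero_of_integral_contDiff_smul_eq_zero hf.locallyIntegrableOn fun g hg hgc hgs => ?_)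
  have hψ : IsTestFunction Ω fun x => (g x : ℂ) := by
    refine ⟨Complex.ofRealCLM.contDiff.comp hg, hgc.comp_left Complex.ofReal_zero, ?_⟩
    exact (closure_mono (Function.support_comp_subset Complex.ofReal_zero g)).trans hgs
  have h1 := h _ hψ
  rw [L2.inner_def] at h1
  rw [← setIntegral_eq_integral_of_forall_compl_eq_zero (s := Ω) fun x hx => by
    rw [image_eq_zero_of_notMem_tsupport fun h => hx (hgs h), zero_smul], ← h1]
  refine integral_congr_ae ?_
  filter_upwards [hψ.memLp.coeFn_toLp] with x hx
  rw [hx, RCLike.inner_apply]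
  simp [mul_comm]

/-- Indicators of infinitely many disjoint nonempty open subsets of `Ω` are orthogonal and nonzero.
-/
theorem not_finiteDimensional_L2 (hN : 1 ≤ N) (hΩ : IsOpen Ω) (hne : Ω.Nonempty)
    [IsFiniteMeasure (volume.restrict Ω)] : ¬ FiniteDimensional ℂ (L2 Ω) := by
  intro hfd
  obtain ⟨x, hx⟩ := hne
  have : Nonempty (Fin N) := ⟨⟨0, hN⟩⟩
  have : Infinite Ω := (infinite_of_mem_nhds x (hΩ.mem_nhds hx)).to_subtype
  obtain ⟨U, hUi, hUo, hUd⟩ := exists_seq_infinite_isOpen_pairwise_disjoint Ω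
  let V : ℕ → Set (EuclideanSpace ℝ (Fin N)) := fun n => Subtype.val '' U n
  have hVo : ∀ n, IsOpen (V n) := fun n => hΩ.isOpenMap_subtype_val _ (hUo n)
  have hVm : ∀ n, MeasurableSet (V n) := fun n => (hVo n).measurableSet
  have hVΩ : ∀ n, V n ⊆ Ω := fun n => by rintro _ ⟨y, -, rfl⟩; exact y.2
  have hVd : Pairwise fun m n => Disjoint (V m) (V n) := fun m n hmn =>
    (disjoint_image_iff Subtype.val_injective).2 (hUd hmn)
  let v : ℕ → L2 Ω := fun n => indicatorConstLp 2 (hVm n) (measure_ne_top _ _) 1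
  have hli : LinearIndependent ℂ v := by
    refine linearIndependent_of_ne_zero_of_inner_eq_zero (fun n hn => ?_) fun m n hmn => ?_
    · have h1 : volume.restrict Ω (V n) ≠ 0 := by
        rw [Measure.restrict_apply (hVm n), inter_eq_left.2 (hVΩ n)]
        exact ((hVo n).measure_pos _ ((hUi n).nonempty.image _)).ne'
      have h2 : ‖v n‖ = 0 := by rw [hn, norm_zero]
      simp only [v] at h2
      rw [norm_indicatorConstLp two_ne_zero ENNReal.ofNat_ne_top, norm_one, one_mul,
        Real.rpow_eq_zero (measureReal_nonneg) (by simp)] at h2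
      exact h1 ((measureReal_eq_zero_iff (measure_ne_top _ _)).1 h2)
    · simp only [v]
      rw [L2.inner_indicatorConstLp_one, setIntegral_indicatorConstLp (hVm m),
        inter_comm, (hVd hmn).inter_eq]
      simp
  have := hli.finite
  exact not_finite ℕ

end

/-! ### Existence of the Dirichlet eigenbasis. -/

section

variable {N : ℕ} {Ω : Set (EuclideanSpace ℝ (Fin N))}
  {A : EuclideanSpace ℝ (Fin N) → EuclideanSpace ℝ (Fin N)}

section

variable {a : ℝ} (hΩ : IsOpen Ω) (hA : ContinuousOn A Ω) (ha : ∀ x ∈ Ω, ‖A x‖ ≤ a)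
include hΩ hA ha

/-- The range of `J` contains all test functions, hence is dense; this excludes the eigenvalue `0`
of `J J*`. -/
theorem adjoint_dirichletEmbedding_injective [IsFiniteMeasure (volume.restrict Ω)] {f : L2 Ω}
    (hf : (dirichletEmbedding Ω A).adjoint f = 0) : f = 0 := by
  refine eq_zero_of_forall_inner_testFunction hΩ fun ψ hψ => ?_
  have := (dirichletEmbedding Ω A).adjoint_inner_right ⟨_, subset_closure
    (hψ.pair_mem_testGraph hΩ hA ha)⟩ f
  rw [hf, inner_zero_right] at this
  exact this.symm

/-- Eigenvectors of `J J*`, with `J` the embedding of `𝓗¹₀(Ω)` into `L²(Ω)`, are Dirichlet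
eigenfunctions with positive eigenvalue. -/
theorem exists_isDirichletEigenfunction (hN : 1 ≤ N) [IsFiniteMeasure (volume.restrict Ω)] {R : ℝ}
    (hR : ∀ x ∈ Ω, ‖x‖ ≤ R) {φ : L2 Ω} (hφ : φ ≠ 0) {μ : ℂ}
    (h : dirichletEmbedding Ω A ((dirichletEmbedding Ω A).adjoint φ) = μ • φ) :
    ∃ l : ℝ, 0 < l ∧ IsDirichletEigenfunction Ω A (l ^ 2) φ := by
  set J := dirichletEmbedding Ω A
  set x := J.adjoint φ with hx
  have hx0 : x ≠ 0 := fun h0 => hφ (adjoint_dirichletEmbedding_injective hΩ hA ha h0)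
  have hμr : μ * (‖φ‖ ^ 2 : ℝ) = (‖x‖ ^ 2 : ℝ) := by
    have h1 : inner ℂ φ (J x) = inner ℂ x x := by
      rw [hx, ContinuousLinearMap.adjoint_inner_left]
    rw [h, inner_smul_right, inner_self_eq_norm_sq_to_K] at h1
    push_cast
    exact h1.trans (inner_self_eq_norm_sq_to_K (𝕜 := ℂ) x)
  have hφn : 0 < ‖φ‖ ^ 2 := by positivity
  obtain ⟨m, hm0, rfl⟩ : ∃ m : ℝ, 0 < m ∧ μ = m := by
    refine ⟨‖x‖ ^ 2 / ‖φ‖ ^ 2, by positivity, ?_⟩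
    rw [Complex.ofReal_div, eq_div_iff (by exact_mod_cast hφn.ne'), hμr]
  -- The scaling gives `J y = φ`, so the remaining components of `y` are `(i∇ + A)φ`.
  set y : dirichletSpace Ω A := (m : ℂ)⁻¹ • x with hy
  have hmc : (m : ℂ) ≠ 0 := by exact_mod_cast hm0.ne'
  have hyφ : (y : PairSpace Ω) none = φ := by
    have : J y = φ := by rw [hy, map_smul, h, smul_smul, inv_mul_cancel₀ hmc, one_smul]
    exact this
  have hyi : ∀ z : dirichletSpace Ω A, inner ℂ z y = (m : ℂ)⁻¹ * inner ℂ (J z) φ := fun z => by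
    refine (inner_smul_right (𝕜 := ℂ) z x _).trans ?_
    rw [hx, ContinuousLinearMap.adjoint_inner_right]
  have hyD := isDirichlet_of_mem hΩ hA ha y.2
  rw [hyφ] at hyD
  -- The graph inner product contains the term `(v, φ)`; removing it turns `m⁻¹` into `m⁻¹ - 1`.
  have hev : ∀ (v : L2 Ω) (g : Fin N → L2 Ω), IsDirichlet Ω A v g →
      ∑ j, inner ℂ (g j) ((y : PairSpace Ω) (some j)) = ((m⁻¹ - 1 : ℝ) : ℂ) * inner ℂ v φ := by
    intro v g hv
    have h2 := hyi ⟨_, hv.pair_mem hΩ hA ha⟩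
    have h3 : inner ℂ (⟨_, hv.pair_mem hΩ hA ha⟩ : dirichletSpace Ω A) y =
        inner ℂ v φ + ∑ j, inner ℂ (g j) ((y : PairSpace Ω) (some j)) := by
      rw [Submodule.coe_inner, PiLp.inner_apply, Fintype.sum_option, hyφ]
      rfl
    have h4 : J ⟨_, hv.pair_mem hΩ hA ha⟩ = v := rfl
    rw [h3, h4] at h2
    push_cast
    linear_combination h2
  -- Testing with `φ` itself; Poincaré's inequality keeps its magnetic gradient from vanishing.
  have hpos : 0 < m⁻¹ - 1 := by
    have h5 := hev _ _ hyD
    simp only [inner_self_eq_norm_sq_to_K] at h5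
    have h6 : ∑ j, ‖(y : PairSpace Ω) (some j)‖ ^ 2 = (m⁻¹ - 1) * ‖φ‖ ^ 2 := by
      have : ((∑ j, ‖(y : PairSpace Ω) (some j)‖ ^ 2 : ℝ) : ℂ) =
          (((m⁻¹ - 1) * ‖φ‖ ^ 2 : ℝ) : ℂ) := by
        push_cast at h5 ⊢
        exact h5
      exact_mod_cast this
    have h7 := dirichletSpace_poincare hΩ hA ha hR ⟨0, hN⟩ y.2
    rw [hyφ] at h7
    have h8 : ‖(y : PairSpace Ω) (some ⟨0, hN⟩)‖ ^ 2 ≤ ∑ j, ‖(y : PairSpace Ω) (some j)‖ ^ 2 :=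
      Finset.single_le_sum (f := fun j => ‖(y : PairSpace Ω) (some j)‖ ^ 2)
        (fun j _ => sq_nonneg _) (Finset.mem_univ _)
    rw [h6] at h8
    have h9 : 0 < 4 * R ^ 2 * ‖(y : PairSpace Ω) (some ⟨0, hN⟩)‖ ^ 2 := hφn.trans_le h7
    have h10 : 0 < ‖(y : PairSpace Ω) (some ⟨0, hN⟩)‖ ^ 2 :=
      pos_of_mul_pos_right h9 (by positivity)
    exact pos_of_mul_pos_left (h10.trans_le h8) hφn.le
  refine ⟨√(m⁻¹ - 1), Real.sqrt_pos.2 hpos, _, hyD, ?_⟩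
  rw [Real.sq_sqrt hpos.le]
  exact hev

end

/-- The Dirichlet realization of `(i∇ + A)²` on a bounded open set has an orthonormal basis of
eigenfunctions with positive eigenvalues. -/
theorem nonempty_eigenbasis (hN : 1 ≤ N) (hΩ : IsOpen Ω) (hb : Bornology.IsBounded Ω)
    (hne : Ω.Nonempty) (hA : ContinuousOn A (closure Ω)) : Nonempty (Eigenbasis Ω A) := by
  obtain ⟨R, hR⟩ := hb.exists_norm_le
  obtain ⟨a, ha⟩ := hb.isCompact_closure.exists_bound_of_continuousOn hA
  replace ha : ∀ x ∈ Ω, ‖A x‖ ≤ a := fun x hx => ha x (subset_closure hx)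
  replace hA : ContinuousOn A Ω := hA.mono subset_closure
  have : IsFiniteMeasure (volume.restrict Ω) :=
    isFiniteMeasure_restrict.2 hb.measure_lt_top.ne
  set J := dirichletEmbedding Ω A
  have hK : IsCompactOperator (J ∘SL J.adjoint) :=
    (isCompactOperator_dirichletEmbedding hΩ hA ha hR).comp_clm J.adjoint
  have hs : (J ∘SL J.adjoint).IsSymmetric :=
    (ContinuousLinearMap.isPositive_self_comp_adjoint J).isSymmetric
  have : Fact ((2 : ℝ≥0∞) ≠ ⊤) := ⟨ENNReal.ofNat_ne_top⟩
  obtain ⟨φ, hφ⟩ := exists_hilbertBasis_of_isCompactOperator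
    (not_finiteDimensional_L2 hN hΩ hne) hK hs
  choose μ hμ using hφ
  choose l hl hle using fun k => exists_isDirichletEigenfunction hΩ hA ha hN hR
    (φ.orthonormal.ne_zero k) (hμ k)
  exact ⟨⟨φ, l, hl, hle⟩⟩

end

end MagneticWave

/-! ### Choice of the constants and conclusion. -/

theorem theorem1p1 (C₁ C₂ C₃ : ℝ) (hC₁ : 0 < C₁) (hC₂ : 0 < C₂) (hC₃ : 0 < C₃) :
    ∃ P : ℕ, 0 < P ∧ ∃ c₁ : ℝ, 0 < c₁ ∧
      ∀ (N : ℕ), 1 ≤ N →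
      ∀ (Ω : Set (EuclideanSpace ℝ (Fin N))), IsOpen Ω → Bornology.IsBounded Ω → Ω.Nonempty →
        MagneticWave.HasC2Boundary Ω →
      ∀ (A : EuclideanSpace ℝ (Fin N) → EuclideanSpace ℝ (Fin N)),
        ContDiffOn ℝ 1 A (closure Ω) →
      Nonempty (MagneticWave.Eigenbasis Ω A) ∧
      ∀ (Φ : MagneticWave.Eigenbasis Ω A)
        (T : ℝ) (_ : 0 < T)
        (ν : ℝ → ℝ) (_ : ContinuousOn ν (Set.Ioc 0 T)) (_ : StrictAntiOn ν (Set.Ioc 0 T))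
        (C₄ : ℝ) (_ : 0 < C₄) (_ : ∀ t ∈ Set.Ioc 0 T, C₄ ≤ ν t)
        (b : ℝ → ℝ) (_ : ∀ t ∈ Set.Ioc 0 T, C₁ ≤ b t ∧ b t ≤ C₂)
        (_ : ContDiffOn ℝ 2 b (Set.Ioc 0 T))
        (_ : ∀ k ∈ ({1, 2} : Set ℕ), ∀ t ∈ Set.Ioc 0 T,
          |iteratedDerivWithin k b (Set.Ioc 0 T) t| ≤ C₃ * (ν t / t) ^ k)
        (s : ℝ) (_ : 1 ≤ s)
        (u₀ u₁ : MagneticWave.L2 Ω) (_ : Φ.MemSobolev s (Φ.coeff u₀))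
        (_ : Φ.MemSobolev (s - 1) (Φ.coeff u₁)),
        ∃ u ut : ℝ → ℕ → ℂ,
          Φ.IsSolution T b u₀ u₁ u ut ∧
          Φ.ContinuousInImage (MagneticWave.lossSymbol T ν P c₁) T s u ∧
          Φ.ContinuousInImage (MagneticWave.lossSymbol T ν P c₁) T (s - 1) ut ∧
          ∀ w wt : ℝ → ℕ → ℂ, Φ.IsSolution T b u₀ u₁ w wt →
            ∀ t ∈ Set.Icc 0 T, w t = u t ∧ wt t = ut t := by
  -- The condition `C₃ / C₁² ≤ 2^P` keeps the adiabatic correction small; passing to `P + 1` ensures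
  -- positivity.
  obtain ⟨P, hP⟩ := pow_unbounded_of_one_lt (C₃ / C₁ ^ 2) (one_lt_two (α := ℝ))
  have hP' : C₃ / C₁ ^ 2 ≤ 2 ^ (P + 1) :=
    hP.le.trans (pow_le_pow_right₀ one_le_two (Nat.le_succ P))
  refine ⟨P + 1, P.succ_pos, MagneticWave.lossRate C₁ C₂ C₃ (2 ^ (P + 1)),
    by unfold MagneticWave.lossRate; positivity, ?_⟩
  intro N hN Ω hΩ hb hne _ A hA
  refine ⟨MagneticWave.nonempty_eigenbasis hN hΩ hb hne hA.continuousOn, ?_⟩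
  intro Φ T hT ν hνc hνa C₄ hC₄ hν b hbb hbd hbk s _ u₀ u₁ hu₀ hu₁
  exact Φ.exists_isSolution hC₁ hC₂ hC₃ hP' hT hνc hνa hC₄ hν hbb hbd hbk hu₀ hu₁
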